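/- **Model.** Let either $\mathbb X=\mathbb R$, $\mathbb A=[0,\infty)$, or $\mathbb X=\mathbb Z$, $\mathbb A=\{0,1,2,\dots\}$. Let $K>0$, $\bar c>0$, let $h:\mathbb X\to[0,\infty)$ be convex with $h(0)=0$ and $h(x)\to\infty$ as $|x|\to\infty$, and let $D_1,D_2,\dots$ be i.i.d. nonnegative $\mathbb X$-valued random variables, distributed as $D$, with $E[D]<\infty$, $P(D>0)>0$ and $E[h(x-D)]<\infty$ for all $x\in\mathbb X$. The inventory evolves by $x_{t+1}=x_t+a_t-D_{t+1}$, with order quantities $a_t\in\mathbb A$ and one-step costs $c(x,a)=K\mathbf 1\{a>0\}+\bar c a+E[h(x+a-D)]$. For a discount factor $\alpha\in[0,1)$ and a (randomized, history-dependent) policy $\pi$ let $v^\pi_{N,\alpha}(x)=E^\pi_x\sum_{t=0}^{N-1}\alpha^t c(x_t,a_t)$ and $v^\pi_\alpha(x)=E^\pi_x\sum_{t=0}^{\infty}\alpha^t c(x_t,a_t)$, and let $v_{N,\alpha}=\inf_\pi v^\pi_{N,\alpha}$ and $v_\alpha=\inf_\pi v^\pi_\alpha$. A policy $\pi$ is optimal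 (for the infinite-horizon problem) if $v^\pi_\alpha(x)=v_\alpha(x)$ for all $x\in\mathbb X$. For $s\le S$ the $(s,S)$ policy orders up to $S$ whenever $x_t<s$ and does not order whenever $x_t\ge s$. For $t=0,1,\dots$ put $$G_{t,\alpha}(x)=\bar c x+E[h(x-D)]+\alpha E[v_{t,\alpha}(x-D)],\qquad G_\alpha(x)=\bar c x+E[h(x-D)]+\alpha E[v_\alpha(x-D)],$$ $$f_{t,\alpha}(x)=\bar c x+\sum_{i=0}^t\alpha^iE\big[h(x-D_1-\dots-D_{i+1})\big],\qquad N_\alpha=\inf\Big\{t\ge 0:\lim_{x\to-\infty}f_{t,\alpha}(x)=+\infty\Big\}$$ (with $\inf\emptyset=+\infty$), and $\alpha^*=1-k_h/\bar c$, where $k_h=-\lim_{x\to-\infty}h(x)/x\in(0,+\infty]$. Say that $(s,S)$ is a *pair for* $f$ if $S\in\operatorname{argmin}_{x\in\mathbb X}f(x)$ and $s=\inf\{x\in\mathbb X: x\le S,\ f(x)\le K+f(S)\}$ is finite. **Theorem.** Let $\alpha\in[0,1)$. 1. Suppose $\alpha>\alpha^*$. Then $G_\alpha$ has a minimizer, every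 minimizer $S_\alpha$ belongs to a pair $(s_\alpha,S_\alpha)$ for $G_\alpha$, and for every such pair the $(s_\alpha,S_\alpha)$ policy is optimal for the infinite-horizon problem. Moreover, $N_\alpha<\infty$; for each $t\ge N_\alpha$ the function $G_{t,\alpha}$ has a minimizer, and every minimizer $S_{t,\alpha}$ belongs to a pair $(s_{t,\alpha},S_{t,\alpha})$ for $G_{t,\alpha}$; every sequence $\{(s_{t,\alpha},S_{t,\alpha})\}_{t\ge N_\alpha}$ of such pairs is bounded; and if $(s^*_\alpha,S^*_\alpha)$ is a limit point of such a sequence, then $s^*_\alpha\le S^*_\alpha$ and the $(s^*_\alpha,S^*_\alpha)$ policy is optimal for the infinite-horizon problem. 2. Suppose $\alpha\le\alpha^*$. Then the policy that never orders is optimal for the infinite-horizon problem. -/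

import Mathlib

open MeasureTheory ProbabilityTheory Filter Topology
open scoped ENNReal

namespace Inventory

/-- Order quantities: the nonnegative elements of the state space `X`. -/
abbrev Act (X : AddSubgroup ℝ) : Type := {a : X // 0 ≤ a}

/-- Histories `(x_0, a_0, …, x_{t-1}, a_{t-1}, x_t)` up to period `t`, that is `(X × A)^t × X`. -/
abbrev Hist (X : AddSubgroup ℝ) (t : ℕ) : Type := (Fin t → X × Act X) × X

/-- The parameters of the inventory model, with its standing assumptions. The state space is an
additive subgroup `X` of `ℝ` (later `ℝ` itself or `ℤ`). The variable `D t` is the demand that is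
realized in period `t`, after the order of period `t` has arrived. -/
structure Model (X : AddSubgroup ℝ) {Ω : Type*} [MeasurableSpace Ω] (P : Measure Ω) where
  /-- fixed ordering cost -/
  K : ℝ
  K_pos : 0 < K
  /-- ordering cost per unit -/
  c : ℝ
  c_pos : 0 < c
  /-- holding/backordering cost per period -/
  h : X → ℝ
  h_convex : ∀ (x y z : X) (l : ℝ), 0 ≤ l → l ≤ 1 → (z : ℝ) = (1 - l) * x + l * y →
    h z ≤ (1 - l) * h x + l * h y
  h_nonneg : ∀ x, 0 ≤ h x
  h_zero : h 0 = 0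
  h_atBot : Tendsto h atBot atTop
  h_atTop : Tendsto h atTop atTop
  /-- demands -/
  D : ℕ → Ω → X
  D_measurable : ∀ t, Measurable (D t)
  D_indep : iIndepFun D P
  D_identDistrib : ∀ t, IdentDistrib (D t) (D 0) P P
  D_nonneg : ∀ t, ∀ᵐ ω ∂P, 0 ≤ D t ω
  D_integrable : Integrable (fun ω => (D 0 ω : ℝ)) P
  D_pos : 0 < P {ω | 0 < D 0 ω}
  /-- the expected one-period holding cost is finite -/
  h_integrable : ∀ x, Integrable (fun ω => h (x - D 0 ω)) P

/-- A (randomized, history-dependent) policy: a sequence of transition probabilities from the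
histories to the actions. -/
structure Policy (X : AddSubgroup ℝ) where
  rule : ∀ t, Kernel (Hist X t) (Act X)
  markov : ∀ t, IsMarkovKernel (rule t)

attribute [instance] Policy.markov

/-- The non-randomized stationary policy that uses the decision function `φ` in every period. -/
noncomputable def stationary {X : AddSubgroup ℝ} (φ : X → Act X) (hφ : Measurable φ) :
    Policy X where
  rule t := Kernel.deterministic (fun b : Hist X t => φ b.2) (hφ.comp measurable_snd)
  markov _ := inferInstance

/-- The policy that never orders. -/
noncomputable def neverOrder (X : AddSubgroup ℝ) : Policy X :=
  stationary (fun _ => ⟨0, le_rfl⟩) measurable_const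

/-- The `(s, S)` decision: order up to `S` if the inventory level `x` is below `s`, and do not
order otherwise. -/
noncomputable def sSAction {X : AddSubgroup ℝ} (s S : X) (hsS : s ≤ S) (x : X) : Act X :=
  if hx : x < s then ⟨S - x, sub_nonneg.2 (hx.le.trans hsS)⟩ else ⟨0, le_rfl⟩

lemma measurable_sSAction {X : AddSubgroup ℝ} (s S : X) (hsS : s ≤ S) :
    Measurable (sSAction s S hsS) := by
  have hval : (fun x : X => (((sSAction s S hsS x : Act X) : X) : ℝ)) =
      fun x : X => if (x : ℝ) < s then (S : ℝ) - x else 0 := by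
    funext x
    by_cases hx : x < s
    · have hx' : (x : ℝ) < s := hx
      simp [sSAction, hx]
    · have hx' : ¬ (x : ℝ) < s := hx
      simp [sSAction, hx]
  refine Measurable.subtype_mk (p := fun a : X => 0 ≤ a)
    (f := fun x => ((sSAction s S hsS x : Act X) : X)) (Measurable.subtype_mk
      (p := fun r : ℝ => r ∈ X)
      (f := fun x : X => (((sSAction s S hsS x : Act X) : X) : ℝ)) ?_)
  rw [hval]
  exact Measurable.ite (measurableSet_lt measurable_subtype_coe measurable_const)
    (measurable_const.sub measurable_subtype_coe) measurable_const

/-- The `(s, S)` policy. -/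
noncomputable def sSPolicy {X : AddSubgroup ℝ} (s S : X) (hsS : s ≤ S) : Policy X :=
  stationary (sSAction s S hsS) (measurable_sSAction s S hsS)

namespace Model

variable {X : AddSubgroup ℝ} {Ω : Type*} [MeasurableSpace Ω] {P : Measure Ω} (M : Model X P)

/-- The law of the history `(x_0, a_0, …, x_t)` under the policy `π` from the initial state `x`:
given the history up to period `t`, the action `a_t` is drawn from `π_t`, the demand is independent
of the history and of `a_t`, and `x_{t+1} = x_t + a_t - demand`. -/
noncomputable def histLaw (π : Policy X) (x : X) : ∀ t, Measure (Hist X t)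
  | 0 => Measure.dirac (Fin.elim0, x)
  | t + 1 =>
    ((histLaw π x t ⊗ₘ π.rule t).prod (P.map (M.D t))).map
      (fun q : (Hist X t × Act X) × X =>
        (Fin.snoc (α := fun _ => X × Act X) q.1.1.1 (q.1.1.2, q.1.2),
          q.1.1.2 + (q.1.2 : X) - q.2))

/-- The expected one-period holding cost `E[h(x - D)]`. -/
noncomputable def expHold (x : X) : ℝ≥0∞ := ∫⁻ ω, ENNReal.ofReal (M.h (x - M.D 0 ω)) ∂P

open Classical in
/-- The one-step cost `c(x, a) = K 1{a > 0} + c a + E[h(x + a - D)]`. -/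
noncomputable def cost (x : X) (a : Act X) : ℝ≥0∞ :=
  (if 0 < (a : X) then ENNReal.ofReal M.K else 0) + ENNReal.ofReal (M.c * ((a : X) : ℝ))
    + M.expHold (x + (a : X))

/-- The expected cost `E_x^π[c(x_t, a_t)]` of period `t`. -/
noncomputable def stageCost (π : Policy X) (x : X) (t : ℕ) : ℝ≥0∞ :=
  ∫⁻ p, M.cost p.1.2 p.2 ∂(M.histLaw π x t ⊗ₘ π.rule t)

/-- The expected total discounted cost of `π` over the horizon `N`. -/
noncomputable def finCost (α : ℝ) (N : ℕ) (π : Policy X) (x : X) : ℝ≥0∞ :=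
  ∑ t ∈ Finset.range N, ENNReal.ofReal α ^ t * M.stageCost π x t

/-- The expected total discounted cost of `π` over the infinite horizon (the costs are nonnegative,
so the expectation of the series is the series of the expectations). -/
noncomputable def infCost (α : ℝ) (π : Policy X) (x : X) : ℝ≥0∞ :=
  ∑' t, ENNReal.ofReal α ^ t * M.stageCost π x t

/-- The optimal value for the horizon `N`. -/
noncomputable def finValue (α : ℝ) (N : ℕ) (x : X) : ℝ≥0∞ := ⨅ π : Policy X, M.finCost α N π x

/-- The optimal value for the infinite horizon. -/
noncomputable def infValue (α : ℝ) (x : X) : ℝ≥0∞ := ⨅ π : Policy X, M.infCost α π x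

/-- Optimality of a policy for the infinite-horizon problem with discount factor `α`. -/
def IsOptimal (α : ℝ) (π : Policy X) : Prop := ∀ x, M.infCost α π x = M.infValue α x

/-- `G_{t,α}(x) = c x + E[h(x - D)] + α E[v_{t,α}(x - D)]`. -/
noncomputable def finG (α : ℝ) (t : ℕ) (x : X) : EReal :=
  ((M.c * (x : ℝ) : ℝ) : EReal) +
    ((M.expHold x + ENNReal.ofReal α * ∫⁻ ω, M.finValue α t (x - M.D 0 ω) ∂P : ℝ≥0∞) : EReal)

/-- `G_α(x) = c x + E[h(x - D)] + α E[v_α(x - D)]`. -/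
noncomputable def infG (α : ℝ) (x : X) : EReal :=
  ((M.c * (x : ℝ) : ℝ) : EReal) +
    ((M.expHold x + ENNReal.ofReal α * ∫⁻ ω, M.infValue α (x - M.D 0 ω) ∂P : ℝ≥0∞) : EReal)

/-- `S` is a minimizer of `f` over the state space. -/
def IsArgmin (f : X → EReal) (S : X) : Prop := ∀ x, f S ≤ f x

/-- `s = inf {x ≤ S : f(x) ≤ K + f(S)}`, as an element of the state space. -/
def IsReorderPoint (f : X → EReal) (S s : X) : Prop :=
  IsGLB {x : X | x ≤ S ∧ f x ≤ ((M.K : ℝ) : EReal) + f S} s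

/-- The limit `k_h = - lim_{x → -∞} h(x) / x`, an extended real number. -/
noncomputable def kh : EReal := - limUnder atBot (fun x : X => ((M.h x / (x : ℝ) : ℝ) : EReal))

/-- `α* = 1 - k_h / c`. -/
noncomputable def alphaStar : EReal := 1 - M.kh / ((M.c : ℝ) : EReal)

/-- `f_{t,α}(x) = c x + ∑_{i=0}^t α^i E[h(x - (D_1 + … + D_{i+1}))]`; the summands of the total
demand are `D 0, …, D i` here. -/
noncomputable def fFun (α : ℝ) (t : ℕ) (x : X) : EReal :=
  ((M.c * (x : ℝ) : ℝ) : EReal) +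
    ((∑ i ∈ Finset.range (t + 1), ENNReal.ofReal α ^ i *
      ∫⁻ ω, ENNReal.ofReal (M.h (x - ∑ j ∈ Finset.range (i + 1), M.D j ω)) ∂P : ℝ≥0∞) : EReal)

/-- `N_α = inf {t : f_{t,α}(-∞) = +∞}`, with `inf ∅ = +∞`. -/
noncomputable def Nalpha (α : ℝ) : ℕ∞ :=
  ⨅ (t : ℕ) (_ : Tendsto (M.fFun α t) atBot (𝓝 ⊤)), (t : ℕ∞)

end Model

end Inventory

set_option linter.unusedSectionVars false

/-! All costs are nonnegative, so the dynamic programming is done in `[0, ∞]`. Value iterates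
`viter` increase from `0` and equal the finite-horizon values; their limit `vlim` lies below
`infValue`. Conversely, any supersolution of the evaluation equation of a stationary policy bounds
that policy's cost (`infCost_stationary_le`). Compactness of the sets of cheap orders makes `vlim` a
supersolution of the optimality equation (`exists_qval_post_vlim_le`), so a stationary policy that
minimizes its right-hand side costs at most `vlim` and is optimal. Uniqueness of solutions is never
needed.

Scarf's argument says when such a policy is of `(s, S)` type: `K`-convexity survives the Bellman
operator (`kConvex_gfun_bellman`) and limits, and for a `K`-convex `G` an `(s, S)` rule built from a
minimizer is optimal (`qval_sSAction_le`). Existence of `s` and `S` then needs only coercivity of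
`G`. At `+∞` the term `c x` suffices. At `-∞`, if `h` has slope at least `q` in absolute value, the
iterate `v_N` has slope at least `min(c, q ∑_{i<N} α^i)`, so `G_N` is coercive as soon as `c < q
∑_{i≤N} α^i`. The same inequality governs `f_N → ∞`, which explains `N_α`; it holds for some `N`
exactly when `(1 - α) c < q`, which is `α > α*`. Limit points are handled by `G_t ↑ G` with every
`G_t` lower semicontinuous.

If `α ≤ α*`, then `h` falls by at most `(1 - α) c` per unit, so the cost of never ordering falls by
at most `c` per unit: an order never saves more than its price. -/

namespace Inventory

/-! ### Topology and measurability on the state space. -/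

section StateSpace

variable {X : AddSubgroup ℝ}

lemma isClosed_stateSpace (hX : X = ⊤ ∨ X = (Int.castAddHom ℝ).range) :
    IsClosed (X : Set ℝ) := by
  rcases hX with rfl | rfl
  · simp
  · have := Int.isClosedEmbedding_coe_real.isClosed_range
    have h2 : (((Int.castAddHom ℝ).range : AddSubgroup ℝ) : Set ℝ) = Set.range ((↑) : ℤ → ℝ) := rfl
    rwa [h2]

/-- A closed and bounded subset of the state space is compact. -/
lemma isCompact_of_isClosed_of_abs_le (hXc : IsClosed (X : Set ℝ)) {A : Set X} (hA : IsClosed A)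
    {B : ℝ} (hB : ∀ x ∈ A, |(x : ℝ)| ≤ B) : IsCompact A := by
  have hemb : IsClosedEmbedding ((↑) : X → ℝ) := hXc.isClosedEmbedding_subtypeVal
  rw [hemb.isCompact_iff]
  refine (isCompact_Icc (a := -B) (b := B)).of_isClosed_subset (hemb.isClosedMap _ hA) ?_
  rintro _ ⟨x, hx, rfl⟩
  exact abs_le.1 (hB x hx)

lemma isCompact_actions (hXc : IsClosed (X : Set ℝ)) {A : Set (Act X)} (hA : IsClosed A)
    {B : ℝ} (hB : ∀ a ∈ A, ((a : X) : ℝ) ≤ B) : IsCompact A := by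
  have hemb : IsClosedEmbedding ((↑) : Act X → X) :=
    (isClosed_Ici (a := (0 : X))).isClosedEmbedding_subtypeVal
  rw [hemb.isCompact_iff]
  refine isCompact_of_isClosed_of_abs_le hXc (hemb.isClosedMap _ hA) (B := B) ?_
  rintro _ ⟨a, ha, rfl⟩
  rw [abs_of_nonneg (show (0 : ℝ) ≤ ((a : X) : ℝ) from a.2)]
  exact hB a ha

/-- A monotone function on the state space is measurable. -/
lemma measurable_of_monotone {f : X → X} (hf : Monotone f) : Measurable f := by
  have hlow : ∀ L : Set X, IsLowerSet L → MeasurableSet L := by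
    intro L hL
    -- A lower set of `X` is the trace of its lower closure in ℝ, which is order-connected and hence
    -- Borel.
    have h1 : MeasurableSet (lowerClosure ((↑) '' L : Set ℝ) : Set ℝ) :=
      (LowerSet.lower _).ordConnected.measurableSet
    convert measurable_subtype_coe h1
    ext x
    constructor
    · intro hx
      exact subset_lowerClosure ⟨x, hx, rfl⟩
    · rintro ⟨_, ⟨y, hy, rfl⟩, hxy⟩
      exact hL hxy hy
  refine Measurable.subtype_mk (p := fun r : ℝ => r ∈ X) (f := fun x => ((f x : X) : ℝ)) ?_
  refine measurable_of_Iic fun r => hlow _ ?_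
  intro x y hyx hx
  exact le_trans (show ((f y : X) : ℝ) ≤ f x from hf hyx) hx

end StateSpace

/-! ### Bellman operator, lower semicontinuity and attainment of minima. -/

namespace Model

variable {X : AddSubgroup ℝ} {Ω : Type*} [MeasurableSpace Ω] {P : Measure Ω} (M : Model X P)

/-- A convex function on all of ℝ is continuous, and the integers are discrete. -/
lemma continuous_h (hX : X = ⊤ ∨ X = (Int.castAddHom ℝ).range) : Continuous M.h := by
  rcases hX with rfl | rfl
  · have hc : ConvexOn ℝ Set.univ (fun r : ℝ => M.h ⟨r, AddSubgroup.mem_top r⟩) := by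
      refine ⟨convex_univ, fun x _ y _ a b ha hb hab => ?_⟩
      have := M.h_convex ⟨x, AddSubgroup.mem_top x⟩ ⟨y, AddSubgroup.mem_top y⟩
        ⟨a • x + b • y, AddSubgroup.mem_top _⟩ b hb (by linarith)
        (by simp [← eq_sub_of_add_eq hab])
      simpa [← eq_sub_of_add_eq hab] using this
    have := (hc.continuousOn isOpen_univ).comp_continuous
      (f := fun x : (⊤ : AddSubgroup ℝ) => (x : ℝ)) continuous_subtype_val (fun _ => Set.mem_univ _)
    exact this
  · let e : ℤ ≃ₜ Set.range ((↑) : ℤ → ℝ) := Int.isClosedEmbedding_coe_real.isEmbedding.toHomeomorph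
    have : DiscreteTopology (Set.range ((↑) : ℤ → ℝ)) := e.symm.isEmbedding.discreteTopology
    have h2 : DiscreteTopology ((Int.castAddHom ℝ).range) := this
    exact continuous_of_discreteTopology

/-- The cost of ordering `a` units. -/
noncomputable def orderCost (a : Act X) : ℝ≥0∞ :=
  open Classical in
  (if 0 < (a : X) then ENNReal.ofReal M.K else 0) + ENNReal.ofReal (M.c * ((a : X) : ℝ))

/-- The cost of an inventory level `y` after ordering, when `v` is the cost-to-go. -/
noncomputable def post (α : ℝ) (v : X → ℝ≥0∞) (y : X) : ℝ≥0∞ :=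
  M.expHold y + ENNReal.ofReal α * ∫⁻ ω, v (y - M.D 0 ω) ∂P

/-- The cost of ordering `a` units in state `x` when inventory levels after ordering cost `w`. -/
noncomputable def qval (w : X → ℝ≥0∞) (x : X) (a : Act X) : ℝ≥0∞ :=
  M.orderCost a + w (x + (a : X))

/-- The minimal cost over all orders when inventory levels after ordering cost `w`. -/
noncomputable def bellman (w : X → ℝ≥0∞) (x : X) : ℝ≥0∞ := ⨅ a, M.qval w x a

/-- Value iteration. -/
noncomputable def viter (α : ℝ) : ℕ → X → ℝ≥0∞
  | 0 => 0
  | n + 1 => M.bellman (M.post α (viter α n))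

lemma cost_add (α : ℝ) (v : X → ℝ≥0∞) (x : X) (a : Act X) :
    M.cost x a + ENNReal.ofReal α * ∫⁻ ω, v (x + (a : X) - M.D 0 ω) ∂P
      = M.qval (M.post α v) x a := by
  simp only [cost, qval, orderCost, post, add_assoc]

lemma post_mono (α : ℝ) {v v' : X → ℝ≥0∞} (h : v ≤ v') : M.post α v ≤ M.post α v' := by
  intro y
  unfold post
  gcongr
  exact h _

lemma bellman_mono {w w' : X → ℝ≥0∞} (h : w ≤ w') : M.bellman w ≤ M.bellman w' := by
  intro x
  refine iInf_mono fun a => ?_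
  unfold qval
  gcongr
  exact h _

lemma viter_mono (α : ℝ) : Monotone (M.viter α) := by
  refine monotone_nat_of_le_succ fun n => ?_
  induction n with
  | zero => intro x; exact zero_le
  | succ n ih => exact M.bellman_mono (M.post_mono α ih)

/-- Fatou's lemma along the neighbourhood filter of `y`. -/
lemma lowerSemicontinuous_lintegral_sub {u : X → ℝ≥0∞} (hu : LowerSemicontinuous u) :
    LowerSemicontinuous (fun y => ∫⁻ ω, u (y - M.D 0 ω) ∂P) := by
  rw [lowerSemicontinuous_iff_le_liminf]
  intro y
  refine le_trans (lintegral_mono fun ω => ?_) (lintegral_liminf_le (u := 𝓝 y) fun z =>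
    hu.measurable.comp (measurable_const.sub (M.D_measurable 0)))
  have hcont : Continuous fun z : X => z - M.D 0 ω := continuous_sub_right _
  exact (lowerSemicontinuous_iff_le_liminf.1 (hu.comp hcont)) y

lemma lowerSemicontinuous_const_mul {Y : Type*} [TopologicalSpace Y] {u : Y → ℝ≥0∞}
    (hu : LowerSemicontinuous u) {r : ℝ≥0∞} (hr : r ≠ ⊤) :
    LowerSemicontinuous (fun y => r * u y) :=
  (ENNReal.continuous_const_mul hr).comp_lowerSemicontinuous hu fun _ _ h => by
    dsimp only; gcongr

lemma lowerSemicontinuous_expHold (hh : Continuous M.h) : LowerSemicontinuous M.expHold :=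
  M.lowerSemicontinuous_lintegral_sub (u := fun x => ENNReal.ofReal (M.h x))
    (ENNReal.continuous_ofReal.comp hh).lowerSemicontinuous

lemma lowerSemicontinuous_post (hh : Continuous M.h) (α : ℝ) {v : X → ℝ≥0∞}
    (hv : LowerSemicontinuous v) : LowerSemicontinuous (M.post α v) :=
  (M.lowerSemicontinuous_expHold hh).add
    (lowerSemicontinuous_const_mul (M.lowerSemicontinuous_lintegral_sub hv) ENNReal.ofReal_ne_top)

lemma lowerSemicontinuous_orderCost : LowerSemicontinuous M.orderCost := by
  refine LowerSemicontinuous.add ?_ ?_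
  · have : IsOpen {a : Act X | 0 < (a : X)} := isOpen_lt continuous_const continuous_subtype_val
    have h2 := this.lowerSemicontinuous_indicator (y := ENNReal.ofReal M.K) zero_le
    exact h2
  · refine (ENNReal.continuous_ofReal.comp ?_).lowerSemicontinuous
    exact continuous_const.mul (continuous_subtype_val.comp continuous_subtype_val)

lemma lowerSemicontinuous_qval {w : X → ℝ≥0∞} (hw : LowerSemicontinuous w) :
    LowerSemicontinuous (fun p : X × Act X => M.qval w p.1 p.2) :=
  (M.lowerSemicontinuous_orderCost.comp continuous_snd).add
    (hw.comp (continuous_fst.add (continuous_subtype_val.comp continuous_snd)))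

lemma lowerSemicontinuous_qval_right {w : X → ℝ≥0∞} (hw : LowerSemicontinuous w) (x : X) :
    LowerSemicontinuous (M.qval w x) :=
  (M.lowerSemicontinuous_qval hw).comp
    (continuous_const.prodMk continuous_id : Continuous fun a : Act X => (x, a))

/-- The linear ordering cost bounds every order of bounded total cost; this is the source of
compactness in the action space. -/
lemma le_of_qval_le {w : X → ℝ≥0∞} {x : X} {a : Act X} {r : ℝ≥0∞} (hr : r ≠ ⊤)
    (h : M.qval w x a ≤ r) : ((a : X) : ℝ) ≤ r.toReal / M.c := by
  have h1 : ENNReal.ofReal (M.c * ((a : X) : ℝ)) ≤ r :=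
    le_trans (le_trans le_add_self le_self_add) h
  rw [le_div_iff₀ M.c_pos, mul_comm]
  exact (ENNReal.ofReal_le_iff_le_toReal hr).1 h1

lemma isCompact_qval_le (hXc : IsClosed (X : Set ℝ)) {w : X → ℝ≥0∞} (hw : LowerSemicontinuous w)
    (x : X) {r : ℝ≥0∞} (hr : r ≠ ⊤) : IsCompact {a | M.qval w x a ≤ r} :=
  isCompact_actions hXc ((M.lowerSemicontinuous_qval_right hw x).isClosed_preimage r)
    fun _ ha => M.le_of_qval_le hr ha

/-- The minimum in the optimality equation is attained. -/
lemma exists_qval_eq_bellman (hXc : IsClosed (X : Set ℝ)) {w : X → ℝ≥0∞}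
    (hw : LowerSemicontinuous w) (x : X) : ∃ a, M.qval w x a = M.bellman w x := by
  by_cases htop : M.bellman w x = ⊤
  · exact ⟨⟨0, le_rfl⟩, by rw [htop]; exact top_le_iff.1 (htop ▸ iInf_le _ _)⟩
  · obtain ⟨a₀, ha₀⟩ : ∃ a, M.qval w x a < ⊤ := iInf_lt_iff.1 (lt_top_iff_ne_top.2 htop)
    obtain ⟨a, ha, hmin⟩ := LowerSemicontinuousOn.exists_isMinOn
      (s := {a | M.qval w x a ≤ M.qval w x a₀}) ⟨a₀, le_refl (M.qval w x a₀)⟩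
      (M.isCompact_qval_le hXc hw x ha₀.ne)
      ((M.lowerSemicontinuous_qval_right hw x).lowerSemicontinuousOn _)
    refine ⟨a, le_antisymm (le_iInf fun b => ?_) (iInf_le _ _)⟩
    rcases le_total (M.qval w x b) (M.qval w x a₀) with hb | hb
    · exact hmin hb
    · exact le_trans ha hb

lemma lowerSemicontinuous_bellman (hXc : IsClosed (X : Set ℝ)) {w : X → ℝ≥0∞}
    (hw : LowerSemicontinuous w) : LowerSemicontinuous (M.bellman w) := by
  rw [lowerSemicontinuous_iff_isClosed_preimage]
  intro r
  by_cases hr : r = ⊤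
  · simp [hr]
  let C : Set (Act X) := {a | ((a : X) : ℝ) ≤ r.toReal / M.c}
  have hC : IsCompact C := isCompact_actions hXc
    (isClosed_le (continuous_subtype_val.comp continuous_subtype_val) continuous_const)
    fun _ ha => ha
  have : CompactSpace C := isCompact_iff_compactSpace.1 hC
  have hcl : IsClosed {p : X × C | M.qval w p.1 p.2 ≤ r} :=
    ((M.lowerSemicontinuous_qval hw).comp (continuous_fst.prodMk
      (continuous_subtype_val.comp continuous_snd) :
        Continuous fun p : X × C => (p.1, (p.2 : Act X)))).isClosed_preimage r
  -- The sublevel set of `bellman` is the projection of a closed set along the compact set `C` of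
  -- affordable orders.
  convert isClosedMap_fst_of_compactSpace _ hcl
  ext x
  constructor
  · intro hx
    obtain ⟨a, ha⟩ := M.exists_qval_eq_bellman hXc hw x
    have ha' : M.qval w x a ≤ r := ha.trans_le hx
    exact ⟨(x, ⟨a, M.le_of_qval_le hr ha'⟩), ha', rfl⟩
  · rintro ⟨⟨y, a⟩, ha, rfl⟩
    exact (iInf_le (M.qval w y) (a : Act X)).trans ha

lemma lowerSemicontinuous_viter (hXc : IsClosed (X : Set ℝ)) (hh : Continuous M.h) (α : ℝ)
    (n : ℕ) : LowerSemicontinuous (M.viter α n) := by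
  induction n with
  | zero => exact lowerSemicontinuous_const
  | succ n ih => exact M.lowerSemicontinuous_bellman hXc (M.lowerSemicontinuous_post hh α ih)

lemma measurable_cost (hh : Continuous M.h) :
    Measurable (fun p : X × Act X => M.cost p.1 p.2) := by
  have : (fun p : X × Act X => M.cost p.1 p.2) = fun p : X × Act X => M.qval M.expHold p.1 p.2 := by
    funext p; simp [cost, qval, orderCost]
  rw [this]
  exact (M.lowerSemicontinuous_qval (M.lowerSemicontinuous_expHold hh)).measurable

end Model

/-- The non-randomized Markov policy that uses the decision function `φ t` in period `t`. -/
noncomputable def markovPolicy {X : AddSubgroup ℝ} (φ : ℕ → X → Act X)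
    (hφ : ∀ t, Measurable (φ t)) : Policy X where
  rule t := Kernel.deterministic (fun b : Hist X t => φ t b.2) ((hφ t).comp measurable_snd)
  markov _ := inferInstance

/-! ### History laws and comparison of policy costs with sub- and supersolutions. -/

namespace Model

variable {X : AddSubgroup ℝ} {Ω : Type*} [MeasurableSpace Ω] {P : Measure Ω}
  [IsProbabilityMeasure P] (M : Model X P)

lemma measurable_histStep (t : ℕ) :
    Measurable (fun q : (Hist X t × Act X) × X =>
      ((Fin.snoc (α := fun _ => X × Act X) q.1.1.1 (q.1.1.2, q.1.2),
          q.1.1.2 + (q.1.2 : X) - q.2) : Hist X (t + 1))) := by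
  refine Measurable.prodMk (measurable_pi_iff.2 fun i => ?_) (by fun_prop)
  refine Fin.lastCases ?_ (fun j => ?_) i
  · simp only [Fin.snoc_last]; fun_prop
  · simp only [Fin.snoc_castSucc]; fun_prop

instance isProbabilityMeasure_histLaw (π : Policy X) (x : X) (t : ℕ) :
    IsProbabilityMeasure (M.histLaw π x t) := by
  induction t with
  | zero => unfold histLaw; infer_instance
  | succ t ih =>
    unfold histLaw
    have := Measure.isProbabilityMeasure_map (μ := P) (M.D_measurable t).aemeasurable
    exact Measure.isProbabilityMeasure_map (measurable_histStep t).aemeasurable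

lemma map_D_eq (t : ℕ) : P.map (M.D t) = P.map (M.D 0) := (M.D_identDistrib t).map_eq

lemma measurable_lintegral_sub {u : X → ℝ≥0∞} (hu : Measurable u) :
    Measurable (fun y => ∫⁻ ω, u (y - M.D 0 ω) ∂P) :=
  (hu.comp (measurable_fst.sub ((M.D_measurable 0).comp measurable_snd))).lintegral_prod_right'

lemma measurable_lintegral_next {u : X → ℝ≥0∞} (hu : Measurable u) (t : ℕ) :
    Measurable (fun p : Hist X t × Act X => ∫⁻ ω, u (p.1.2 + (p.2 : X) - M.D 0 ω) ∂P) :=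
  (M.measurable_lintegral_sub hu).comp
    (measurable_fst.snd.add (measurable_subtype_coe.comp measurable_snd))

lemma lintegral_histLaw_succ (π : Policy X) (x : X) (t : ℕ) {u : X → ℝ≥0∞} (hu : Measurable u) :
    ∫⁻ b, u b.2 ∂M.histLaw π x (t + 1)
      = ∫⁻ p, ∫⁻ ω, u (p.1.2 + (p.2 : X) - M.D 0 ω) ∂P ∂(M.histLaw π x t ⊗ₘ π.rule t) := by
  have := Measure.isProbabilityMeasure_map (μ := P) (M.D_measurable 0).aemeasurable
  have hu' : Measurable fun b : Hist X (t + 1) => u b.2 := hu.comp measurable_snd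
  rw [histLaw, map_D_eq, lintegral_map hu' (measurable_histStep t), lintegral_prod]
  · refine lintegral_congr fun p => ?_
    exact lintegral_map (f := fun d => u (p.1.2 + (p.2 : X) - d))
      (hu.comp (measurable_const.sub measurable_id)) (M.D_measurable 0)
  · exact (hu'.comp (measurable_histStep t)).aemeasurable

lemma lintegral_histLaw_compProd (π : Policy X) (x : X) (t : ℕ) {u : X → ℝ≥0∞}
    (hu : Measurable u) :
    ∫⁻ p, u p.1.2 ∂(M.histLaw π x t ⊗ₘ π.rule t) = ∫⁻ b, u b.2 ∂M.histLaw π x t := by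
  conv_rhs => rw [← Measure.fst_compProd (M.histLaw π x t) (π.rule t), Measure.fst]
  have hu' : Measurable fun b : Hist X t => u b.2 := hu.comp measurable_snd
  rw [lintegral_map hu' measurable_fst]

lemma lintegral_histLaw_zero (π : Policy X) (x : X) {u : X → ℝ≥0∞} (hu : Measurable u) :
    ∫⁻ b, u b.2 ∂M.histLaw π x 0 = u x := by
  have hu' : Measurable fun b : Hist X 0 => u b.2 := hu.comp measurable_snd
  rw [histLaw, lintegral_dirac' _ hu']

lemma stageCost_add (hh : Continuous M.h) (α : ℝ) (π : Policy X) (x : X) (t : ℕ) {u : X → ℝ≥0∞}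
    (hu : Measurable u) :
    M.stageCost π x t + ENNReal.ofReal α * ∫⁻ b, u b.2 ∂M.histLaw π x (t + 1)
      = ∫⁻ p, (M.cost p.1.2 p.2 + ENNReal.ofReal α *
          ∫⁻ ω, u (p.1.2 + (p.2 : X) - M.D 0 ω) ∂P) ∂(M.histLaw π x t ⊗ₘ π.rule t) := by
  rw [lintegral_add_left, lintegral_const_mul _ (M.measurable_lintegral_next hu t),
    lintegral_histLaw_succ M π x t hu, stageCost]
  exact (M.measurable_cost hh).comp (measurable_fst.snd.prodMk measurable_snd)

/-- A sequence of subsolutions of the optimality equations is a lower bound for the cost. -/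
lemma le_finCost (hh : Continuous M.h) {α : ℝ} {u : ℕ → X → ℝ≥0∞} (hu : ∀ n, Measurable (u n))
    (h0 : u 0 = 0)
    (hstep : ∀ n x (a : Act X), u (n + 1) x ≤
      M.cost x a + ENNReal.ofReal α * ∫⁻ ω, u n (x + (a : X) - M.D 0 ω) ∂P)
    (N : ℕ) (π : Policy X) (x : X) : u N x ≤ M.finCost α N π x := by
  -- The index of `u` counts the periods that remain. It is left free so that the step to `t + 1`
  -- can use the hypothesis at `n + 1`.
  have key : ∀ t n, u (t + n) x ≤ M.finCost α t π x
      + ENNReal.ofReal α ^ t * ∫⁻ b, u n b.2 ∂M.histLaw π x t := by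
    intro t
    induction t with
    | zero => intro n; simp [finCost, M.lintegral_histLaw_zero π x (hu n)]
    | succ t ih =>
      intro n
      have h1 : ∫⁻ b, u (n + 1) b.2 ∂M.histLaw π x t ≤ M.stageCost π x t
          + ENNReal.ofReal α * ∫⁻ b, u n b.2 ∂M.histLaw π x (t + 1) := by
        rw [M.stageCost_add hh α π x t (hu n),
          ← M.lintegral_histLaw_compProd π x t (hu (n + 1))]
        exact lintegral_mono fun p => hstep n _ _
      calc u (t + 1 + n) x = u (t + (n + 1)) x := by rw [add_assoc, add_comm 1]
        _ ≤ _ := ih (n + 1)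
        _ ≤ M.finCost α t π x + ENNReal.ofReal α ^ t * (M.stageCost π x t
          + ENNReal.ofReal α * ∫⁻ b, u n b.2 ∂M.histLaw π x (t + 1)) := by gcongr
        _ = _ := by rw [finCost, finCost, Finset.sum_range_succ]; ring
  simpa [h0] using key N 0

/-- A sequence of supersolutions of the evaluation equations is an upper bound for the cost of a
Markov policy. -/
lemma finCost_markovPolicy_le (hh : Continuous M.h) {α : ℝ} {φ : ℕ → X → Act X}
    (hφ : ∀ t, Measurable (φ t)) {u : ℕ → X → ℝ≥0∞} (hu : ∀ n, Measurable (u n)) (N : ℕ)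
    (hstep : ∀ t < N, ∀ x, M.cost x (φ t x) + ENNReal.ofReal α *
      ∫⁻ ω, u (t + 1) (x + (φ t x : X) - M.D 0 ω) ∂P ≤ u t x)
    (x : X) : M.finCost α N (markovPolicy φ hφ) x ≤ u 0 x := by
  set π := markovPolicy φ hφ
  -- Here `u` is indexed by elapsed time, not by remaining time as in `le_finCost`.
  have key : ∀ t ≤ N, M.finCost α t π x
      + ENNReal.ofReal α ^ t * ∫⁻ b, u t b.2 ∂M.histLaw π x t ≤ u 0 x := by
    intro t
    induction t with
    | zero => intro _; simp [finCost, M.lintegral_histLaw_zero π x (hu 0)]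
    | succ t ih =>
      intro ht
      have h1 : M.stageCost π x t + ENNReal.ofReal α * ∫⁻ b, u (t + 1) b.2 ∂M.histLaw π x (t + 1)
          ≤ ∫⁻ b, u t b.2 ∂M.histLaw π x t := by
        have hm1 : Measurable fun p : Hist X t × Act X => M.cost p.1.2 p.2 :=
          (M.measurable_cost hh).comp (measurable_fst.snd.prodMk measurable_snd)
        have hm2 := M.measurable_lintegral_next (hu (t + 1)) t
        have hm : Measurable fun p : Hist X t × Act X => M.cost p.1.2 p.2 + ENNReal.ofReal α *
            ∫⁻ ω, u (t + 1) (p.1.2 + (p.2 : X) - M.D 0 ω) ∂P := hm1.add (hm2.const_mul _)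
        rw [M.stageCost_add hh α π x t (hu (t + 1)), Measure.lintegral_compProd hm]
        refine lintegral_mono fun b => ?_
        change ∫⁻ a, _ ∂(Kernel.deterministic (fun b : Hist X t => φ t b.2)
          ((hφ t).comp measurable_snd)) b ≤ _
        rw [Kernel.lintegral_deterministic]
        exact hstep t ht _
      calc _ = M.finCost α t π x + ENNReal.ofReal α ^ t * (M.stageCost π x t
          + ENNReal.ofReal α * ∫⁻ b, u (t + 1) b.2 ∂M.histLaw π x (t + 1)) := by
            rw [finCost, finCost, Finset.sum_range_succ]; ring
        _ ≤ M.finCost α t π x + ENNReal.ofReal α ^ t * ∫⁻ b, u t b.2 ∂M.histLaw π x t := by gcongr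
        _ ≤ _ := ih (Nat.le_of_succ_le ht)
  exact le_self_add.trans (key N le_rfl)

lemma infCost_eq_iSup (α : ℝ) (π : Policy X) (x : X) :
    M.infCost α π x = ⨆ N, M.finCost α N π x := ENNReal.tsum_eq_iSup_nat

lemma finCost_le_infCost (α : ℝ) (N : ℕ) (π : Policy X) (x : X) :
    M.finCost α N π x ≤ M.infCost α π x := ENNReal.sum_le_tsum _

/-- A supersolution of the evaluation equation bounds the cost of a stationary policy. -/
lemma infCost_stationary_le (hh : Continuous M.h) {α : ℝ} {φ : X → Act X} (hφ : Measurable φ)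
    {u : X → ℝ≥0∞} (hu : Measurable u)
    (hstep : ∀ x, M.qval (M.post α u) x (φ x) ≤ u x) (x : X) :
    M.infCost α (stationary φ hφ) x ≤ u x := by
  rw [infCost_eq_iSup]
  refine iSup_le fun N => ?_
  exact M.finCost_markovPolicy_le hh (φ := fun _ => φ) (fun _ => hφ) (u := fun _ => u)
    (fun _ => hu) N (fun _ _ x => by rw [M.cost_add]; exact hstep x) x

/-! ### Finiteness of the values. -/

lemma expHold_ne_top (x : X) : M.expHold x ≠ ⊤ := (M.h_integrable x).lintegral_lt_top.ne

/-- The expected ordering cost of one period's demand. -/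
noncomputable def demandCost : ℝ≥0∞ := ∫⁻ ω, ENNReal.ofReal (M.c * (M.D 0 ω : ℝ)) ∂P

lemma demandCost_ne_top : M.demandCost ≠ ⊤ := (M.D_integrable.const_mul M.c).lintegral_lt_top.ne

lemma exists_convexComb {x y z : X} (hxz : x ≤ z) (hzy : z ≤ y) (hxy : x < y) :
    ∃ l : ℝ, 0 ≤ l ∧ l ≤ 1 ∧ (z : ℝ) = (1 - l) * x + l * y ∧
      l = ((z : ℝ) - x) / ((y : ℝ) - x) := by
  have h1 : (x : ℝ) ≤ z := hxz
  have h2 : (z : ℝ) ≤ y := hzy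
  have h3 : (0 : ℝ) < y - x := sub_pos.2 hxy
  refine ⟨((z : ℝ) - x) / ((y : ℝ) - x), div_nonneg (by linarith) h3.le,
    (div_le_one h3).2 (by linarith), ?_, rfl⟩
  field_simp
  ring

/-- Convexity bounds `h z` by the larger endpoint value; the sum replaces the maximum because it
passes through the expectation. -/
lemma h_le_add {x y z : X} (hxz : x ≤ z) (hzy : z ≤ y) : M.h z ≤ M.h x + M.h y := by
  rcases eq_or_lt_of_le (hxz.trans hzy) with rfl | hxy
  · rw [le_antisymm hzy hxz]; linarith [M.h_nonneg x]
  · obtain ⟨l, h0, h1, hz, -⟩ := exists_convexComb hxz hzy hxy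
    have := M.h_convex x y z l h0 h1 hz
    nlinarith [M.h_nonneg x, M.h_nonneg y]

lemma expHold_le_add (hh : Continuous M.h) {x y z : X} (hxz : x ≤ z) (hzy : z ≤ y) :
    M.expHold z ≤ M.expHold x + M.expHold y := by
  have hm : Measurable fun ω => ENNReal.ofReal (M.h (x - M.D 0 ω)) :=
    (hh.measurable.comp (measurable_const.sub (M.D_measurable 0))).ennreal_ofReal
  rw [expHold, expHold, expHold, ← lintegral_add_left hm]
  refine lintegral_mono fun ω => ?_
  rw [← ENNReal.ofReal_add (M.h_nonneg _) (M.h_nonneg _)]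
  exact ENNReal.ofReal_le_ofReal
    (M.h_le_add (sub_le_sub_right hxz _) (sub_le_sub_right hzy _))

/-- From a nonnegative level, the shortage after one period is at most that period's demand. -/
lemma lintegral_base_le {v : X → ℝ≥0∞} {A : ℝ≥0∞} {R x : X} (hx0 : 0 ≤ x) (hxR : x ≤ R)
    (hv : ∀ z ≤ R, v z ≤ ENNReal.ofReal (M.c * max (-(z : ℝ)) 0) + A) :
    ∫⁻ ω, v (x - M.D 0 ω) ∂P ≤ M.demandCost + A := by
  calc ∫⁻ ω, v (x - M.D 0 ω) ∂P ≤ ∫⁻ ω, (ENNReal.ofReal (M.c * (M.D 0 ω : ℝ)) + A) ∂P := by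
        refine lintegral_mono_ae ?_
        filter_upwards [M.D_nonneg 0] with ω hω
        refine (hv _ ((sub_le_self _ hω).trans hxR)).trans ?_
        have h1 : (0 : ℝ) ≤ x := hx0
        have h2 : (0 : ℝ) ≤ M.D 0 ω := hω
        have h3 := M.c_pos
        gcongr
        simp only [AddSubgroup.coe_sub]
        exact max_le (by linarith) h2
    _ = M.demandCost + A := by
        rw [lintegral_add_right _ measurable_const]; simp [demandCost]

/-- The cost of the policy that orders up to `0` bounds the value iterates uniformly. -/
lemma viter_le (hh : Continuous M.h) {α : ℝ} (hα0 : 0 ≤ α) (hα1 : α < 1) {R : X} (hR : 0 ≤ R) :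
    ∃ A : ℝ≥0∞, A ≠ ⊤ ∧ ∀ n, ∀ x ≤ R, M.viter α n x
      ≤ ENNReal.ofReal (M.c * max (-(x : ℝ)) 0) + A := by
  -- `B` covers one period: the fixed cost, the price of replacing the mean demand, and the holding
  -- cost of any level in `[0, R]`. Then `A` is the fixed point of `A = B + α A`.
  set B : ℝ≥0∞ := ENNReal.ofReal M.K + M.demandCost + (M.expHold 0 + M.expHold R)
  have hB : B ≠ ⊤ := by
    simp [B, M.demandCost_ne_top, M.expHold_ne_top]
  set A : ℝ≥0∞ := ENNReal.ofReal (B.toReal / (1 - α))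
  have hBA : B + ENNReal.ofReal α * A = A := by
    have h1 : 0 < 1 - α := by linarith
    have h2 : 0 ≤ B.toReal / (1 - α) := by positivity
    rw [← ENNReal.ofReal_toReal hB, ← ENNReal.ofReal_mul hα0,
      ← ENNReal.ofReal_add ENNReal.toReal_nonneg (by positivity)]
    congr 1
    field_simp
    ring
  have hα' : ENNReal.ofReal α ≤ 1 := by simpa using hα1.le
  have hstep : ∀ v : X → ℝ≥0∞, (∀ z ≤ R, v z ≤ ENNReal.ofReal (M.c * max (-(z : ℝ)) 0) + A) →
      ∀ x, 0 ≤ x → x ≤ R → ENNReal.ofReal M.K + M.post α v x ≤ A := by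
    intro v hv x hx0 hxR
    calc ENNReal.ofReal M.K + M.post α v x
        ≤ ENNReal.ofReal M.K + ((M.expHold 0 + M.expHold R)
          + ENNReal.ofReal α * (M.demandCost + A)) := by
            unfold post
            gcongr
            · exact M.expHold_le_add hh hx0 hxR
            · exact M.lintegral_base_le hx0 hxR hv
      _ ≤ ENNReal.ofReal M.K + ((M.expHold 0 + M.expHold R)
          + (1 * M.demandCost + ENNReal.ofReal α * A)) := by
            rw [mul_add]; gcongr
      _ = B + ENNReal.ofReal α * A := by simp only [B]; ring
      _ = A := hBA
  refine ⟨A, ENNReal.ofReal_ne_top, fun n => ?_⟩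
  induction n with
  | zero => intro x _; exact zero_le
  | succ n ih =>
    intro x hxR
    rcases le_or_gt 0 x with hx | hx
    · refine (iInf_le _ ⟨0, le_rfl⟩).trans ?_
      have : M.qval (M.post α (M.viter α n)) x ⟨0, le_rfl⟩ = M.post α (M.viter α n) x := by
        simp [qval, orderCost]
      rw [this]
      exact (le_add_self.trans (hstep _ ih x hx hxR)).trans le_add_self
    · refine (iInf_le _ ⟨-x, neg_nonneg.2 hx.le⟩).trans ?_
      have h1 : (x : ℝ) < 0 := hx
      have : M.qval (M.post α (M.viter α n)) x ⟨-x, neg_nonneg.2 hx.le⟩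
          = ENNReal.ofReal (M.c * max (-(x : ℝ)) 0)
            + (ENNReal.ofReal M.K + M.post α (M.viter α n) 0) := by
        simp only [qval, orderCost, neg_pos, hx, if_true, add_neg_cancel, AddSubgroup.coe_neg,
          max_eq_left (neg_nonneg.2 h1.le)]
        ring
      rw [this]
      gcongr
      exact hstep _ ih 0 le_rfl hR

/-- The limit of value iteration. -/
noncomputable def vlim (α : ℝ) (x : X) : ℝ≥0∞ := ⨆ n, M.viter α n x

lemma viter_le_vlim (α : ℝ) (n : ℕ) : M.viter α n ≤ M.vlim α :=
  fun x => le_iSup (fun n => M.viter α n x) n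

lemma exists_vlim_le (hh : Continuous M.h) {α : ℝ} (hα0 : 0 ≤ α) (hα1 : α < 1) (R : X) :
    ∃ A : ℝ≥0∞, A ≠ ⊤ ∧ ∀ x ≤ R, M.vlim α x ≤ ENNReal.ofReal (M.c * max (-(x : ℝ)) 0) + A := by
  obtain ⟨A, hA, h⟩ := M.viter_le hh hα0 hα1 (le_max_right R 0)
  exact ⟨A, hA, fun x hx => iSup_le fun n => h n x (hx.trans (le_max_left _ _))⟩

lemma post_vlim_ne_top (hh : Continuous M.h) {α : ℝ} (hα0 : 0 ≤ α) (hα1 : α < 1) (x : X) :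
    M.post α (M.vlim α) x ≠ ⊤ := by
  obtain ⟨A, hA, h⟩ := M.exists_vlim_le hh hα0 hα1 (max x 0)
  refine ENNReal.add_ne_top.2 ⟨M.expHold_ne_top x, ENNReal.mul_ne_top ENNReal.ofReal_ne_top ?_⟩
  have hle : ∫⁻ ω, M.vlim α (x - M.D 0 ω) ∂P
      ≤ M.demandCost + (ENNReal.ofReal (M.c * |(x : ℝ)|) + A) := by
    calc ∫⁻ ω, M.vlim α (x - M.D 0 ω) ∂P
        ≤ ∫⁻ ω, (ENNReal.ofReal (M.c * (M.D 0 ω : ℝ)) + (ENNReal.ofReal (M.c * |(x : ℝ)|) + A)) ∂P := by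
          refine lintegral_mono_ae ?_
          filter_upwards [M.D_nonneg 0] with ω hω
          refine (h _ ((sub_le_self _ hω).trans (le_max_left _ _))).trans ?_
          have h2 : (0 : ℝ) ≤ M.D 0 ω := hω
          have h3 := M.c_pos
          rw [← add_assoc, ← ENNReal.ofReal_add (by positivity) (by positivity), ← mul_add]
          gcongr
          simp only [AddSubgroup.coe_sub]
          exact max_le (by linarith [neg_abs_le (x : ℝ)]) (by positivity)
      _ = _ := by rw [lintegral_add_right _ measurable_const]; simp [demandCost]
  exact ne_top_of_le_ne_top
    (by simp [M.demandCost_ne_top, hA]) hle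

lemma post_viter_ne_top (hh : Continuous M.h) {α : ℝ} (hα0 : 0 ≤ α) (hα1 : α < 1) (n : ℕ) (x : X) :
    M.post α (M.viter α n) x ≠ ⊤ :=
  ne_top_of_le_ne_top (M.post_vlim_ne_top hh hα0 hα1 x) (M.post_mono α (M.viter_le_vlim α n) x)

lemma vlim_ne_top (hh : Continuous M.h) {α : ℝ} (hα0 : 0 ≤ α) (hα1 : α < 1) (x : X) :
    M.vlim α x ≠ ⊤ := by
  obtain ⟨A, hA, h⟩ := M.exists_vlim_le hh hα0 hα1 x
  exact ne_top_of_le_ne_top (by simp [hA]) (h x le_rfl)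

/-! ### The function `G` and measurable minimizers. -/

/-- `G(y) = c y + w(y)` as a real number, where `w(y)` is the cost of the level `y`. -/
noncomputable def gfun (w : X → ℝ≥0∞) (y : X) : ℝ := M.c * y + (w y).toReal

open Classical in
/-- The fixed cost of an order. -/
noncomputable def setup (a : Act X) : ℝ := if 0 < (a : X) then M.K else 0

lemma setup_nonneg (a : Act X) : 0 ≤ M.setup a := by
  unfold setup; split_ifs; exacts [M.K_pos.le, le_rfl]

/-- The price `c a` is absorbed into `G(x + a) - c x`, so for fixed `x` only the fixed cost and `G`
at the new level matter. -/
lemma toReal_qval {w : X → ℝ≥0∞} (hw : ∀ y, w y ≠ ⊤) (x : X) (a : Act X) :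
    (M.qval w x a).toReal = M.setup a + M.gfun w (x + (a : X)) - M.c * x := by
  have h1 : (0 : ℝ) ≤ ((a : X) : ℝ) := a.2
  have h2 := mul_nonneg M.c_pos.le h1
  have h3 : M.orderCost a = ENNReal.ofReal (M.setup a + M.c * ((a : X) : ℝ)) := by
    rw [ENNReal.ofReal_add (M.setup_nonneg a) h2]
    unfold orderCost setup
    split_ifs <;> simp
  rw [qval, h3, ENNReal.toReal_add ENNReal.ofReal_ne_top (hw _),
    ENNReal.toReal_ofReal (add_nonneg (M.setup_nonneg a) h2), gfun, AddSubgroup.coe_add]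
  ring

lemma qval_ne_top {w : X → ℝ≥0∞} (hw : ∀ y, w y ≠ ⊤) (x : X) (a : Act X) :
    M.qval w x a ≠ ⊤ := by
  refine ENNReal.add_ne_top.2 ⟨?_, hw _⟩
  unfold orderCost
  split_ifs <;> simp

lemma qval_le_qval_iff {w : X → ℝ≥0∞} (hw : ∀ y, w y ≠ ⊤) {x : X} {a b : Act X} :
    M.qval w x a ≤ M.qval w x b
      ↔ M.setup a + M.gfun w (x + (a : X)) ≤ M.setup b + M.gfun w (x + (b : X)) := by
  rw [← ENNReal.toReal_le_toReal (M.qval_ne_top hw _ _) (M.qval_ne_top hw _ _),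
    M.toReal_qval hw, M.toReal_qval hw, sub_le_sub_iff_right]

lemma lowerSemicontinuous_gfun {w : X → ℝ≥0∞} (hw : ∀ y, w y ≠ ⊤) (hlsc : LowerSemicontinuous w) :
    LowerSemicontinuous (M.gfun w) := by
  refine (continuous_const.mul continuous_subtype_val).lowerSemicontinuous.add ?_
  rw [lowerSemicontinuous_iff_isClosed_preimage]
  intro r
  rcases lt_or_ge r 0 with hr | hr
  · convert isClosed_empty
    ext y
    simp [hr.trans_le ENNReal.toReal_nonneg]
  · convert hlsc.isClosed_preimage (ENNReal.ofReal r)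
    ext y
    simp [ENNReal.le_ofReal_iff_toReal_le (hw y) hr]

lemma le_gfun (w : X → ℝ≥0∞) (y : X) : M.c * y ≤ M.gfun w y :=
  le_add_of_nonneg_right ENNReal.toReal_nonneg

/-- The greatest minimizer is taken because it is monotone in `x`, hence measurable. -/
lemma exists_isGreatest_argmin (hXc : IsClosed (X : Set ℝ)) {w : X → ℝ≥0∞} (hw : ∀ y, w y ≠ ⊤)
    (hlsc : LowerSemicontinuous w) (x : X) :
    ∃ y, IsGreatest {y | x ≤ y ∧ ∀ z, x ≤ z → M.gfun w y ≤ M.gfun w z} y := by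
  have hg := M.lowerSemicontinuous_gfun hw hlsc
  have hcomp : ∀ r, IsCompact {y : X | x ≤ y ∧ M.gfun w y ≤ r} := by
    intro r
    refine isCompact_of_isClosed_of_abs_le hXc (isClosed_Ici.inter (hg.isClosed_preimage r))
      (B := max |(x : ℝ)| |r / M.c|) ?_
    rintro y ⟨hxy, hy⟩
    have h1 : (x : ℝ) ≤ y := hxy
    have h2 : (y : ℝ) ≤ r / M.c := by
      rw [le_div_iff₀ M.c_pos, mul_comm]; exact (M.le_gfun w y).trans hy
    exact abs_le_max_abs_abs h1 h2
  obtain ⟨y₀, ⟨hy₀, -⟩, hmin⟩ := LowerSemicontinuousOn.exists_isMinOn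
    (s := {y : X | x ≤ y ∧ M.gfun w y ≤ M.gfun w x}) ⟨x, le_rfl, le_rfl⟩ (hcomp _)
    (hg.lowerSemicontinuousOn _)
  have hmin' : ∀ z, x ≤ z → M.gfun w y₀ ≤ M.gfun w z := by
    intro z hz
    rcases le_total (M.gfun w z) (M.gfun w x) with h | h
    · exact hmin ⟨hz, h⟩
    · exact (hmin (⟨le_rfl, le_rfl⟩ : x ≤ x ∧ M.gfun w x ≤ M.gfun w x)).trans h
  have heq : {y | x ≤ y ∧ ∀ z, x ≤ z → M.gfun w y ≤ M.gfun w z}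
      = {y : X | x ≤ y ∧ M.gfun w y ≤ M.gfun w y₀} := by
    ext y
    exact ⟨fun h => ⟨h.1, h.2 _ hy₀⟩, fun h => ⟨h.1, fun z hz => h.2.trans (hmin' z hz)⟩⟩
  rw [heq]
  exact (hcomp _).exists_isGreatest ⟨y₀, hy₀, le_rfl⟩

/-- A measurable selection of minimizers in the optimality equation. -/
lemma exists_measurable_selector (hXc : IsClosed (X : Set ℝ)) {w : X → ℝ≥0∞} (hw : ∀ y, w y ≠ ⊤)
    (hlsc : LowerSemicontinuous w) :
    ∃ φ : X → Act X, Measurable φ ∧ ∀ x, M.qval w x (φ x) = M.bellman w x := by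
  classical
  choose y hy using M.exists_isGreatest_argmin hXc hw hlsc
  have hmono : Monotone y := by
    intro x x' hxx'
    rcases le_or_gt x' (y x) with h | h
    · exact (hy x').2 ⟨h, fun z hz => (hy x).1.2 z (hxx'.trans hz)⟩
    · exact h.le.trans (hy x').1.1
  have hmy : Measurable y := measurable_of_monotone hmono
  have hmg : Measurable (M.gfun w) := (M.lowerSemicontinuous_gfun hw hlsc).measurable
  have hcond : MeasurableSet {x : X | M.gfun w x ≤ M.K + M.gfun w (y x)} :=
    measurableSet_le hmg (measurable_const.add (hmg.comp hmy))
  refine ⟨fun x => if M.gfun w x ≤ M.K + M.gfun w (y x) then ⟨0, le_rfl⟩ else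
    ⟨y x - x, sub_nonneg.2 (hy x).1.1⟩, Measurable.ite hcond measurable_const ?_, fun x => ?_⟩
  · exact Measurable.subtype_mk (hmy.sub measurable_id)
  · refine le_antisymm (le_iInf fun b => ?_) (iInf_le _ _)
    rw [M.qval_le_qval_iff hw]
    have hb : x ≤ x + (b : X) := le_add_of_nonneg_right b.2
    have hb2 := (hy x).1.2 _ hb
    beta_reduce
    split_ifs with hx
    · rcases eq_or_lt_of_le b.2 with h0 | h0
      · simp [setup, ← h0]
      · simp only [setup, h0, if_true, lt_irrefl, if_false, add_zero, zero_add]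
        linarith
    · rcases eq_or_lt_of_le b.2 with h0 | h0
      · have h1 : M.setup (⟨y x - x, sub_nonneg.2 (hy x).1.1⟩ : Act X) ≤ M.K := by
          unfold setup; split_ifs; exacts [le_rfl, M.K_pos.le]
        push Not at hx
        simp only [← h0, add_sub_cancel, setup, lt_irrefl, if_false, add_zero, zero_add] at h1 ⊢
        linarith
      · have h1 : M.setup (⟨y x - x, sub_nonneg.2 (hy x).1.1⟩ : Act X) ≤ M.setup b := by
          simp only [setup, h0, if_true]; split_ifs; exacts [le_rfl, M.K_pos.le]
        simp only [add_sub_cancel]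
        linarith

lemma viter_le_cost (α : ℝ) (n : ℕ) (x : X) (a : Act X) : M.viter α (n + 1) x ≤
    M.cost x a + ENNReal.ofReal α * ∫⁻ ω, M.viter α n (x + (a : X) - M.D 0 ω) ∂P := by
  rw [M.cost_add]; exact iInf_le _ _

lemma viter_le_finCost (hXc : IsClosed (X : Set ℝ)) (hh : Continuous M.h) (α : ℝ) (N : ℕ)
    (π : Policy X) (x : X) : M.viter α N x ≤ M.finCost α N π x :=
  M.le_finCost hh (fun n => (M.lowerSemicontinuous_viter hXc hh α n).measurable) rfl
    (M.viter_le_cost α) N π x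

/-- The finite-horizon values are the value iterates. -/
theorem finValue_eq_viter (hXc : IsClosed (X : Set ℝ)) (hh : Continuous M.h) {α : ℝ}
    (hα0 : 0 ≤ α) (hα1 : α < 1) (N : ℕ) : M.finValue α N = M.viter α N := by
  funext x
  refine le_antisymm ?_ (le_iInf fun π => M.viter_le_finCost hXc hh α N π x)
  choose φ hφ hsel using fun n => M.exists_measurable_selector hXc
    (M.post_viter_ne_top hh hα0 hα1 n)
    (M.lowerSemicontinuous_post hh α (M.lowerSemicontinuous_viter hXc hh α n))
  -- After the decision of period `t`, there remain `N - 1 - t` periods, so the minimizer for that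
  -- cost-to-go is used.
  refine (iInf_le _ (markovPolicy (fun t => φ (N - 1 - t)) fun t => hφ _)).trans ?_
  refine M.finCost_markovPolicy_le hh _ (u := fun t => M.viter α (N - t))
    (fun n => (M.lowerSemicontinuous_viter hXc hh α _).measurable) N (fun t ht x => ?_) x
  rw [M.cost_add, show N - (t + 1) = N - 1 - t by omega, hsel,
    show N - t = N - 1 - t + 1 by omega]
  rfl

lemma vlim_le_infValue (hXc : IsClosed (X : Set ℝ)) (hh : Continuous M.h) (α : ℝ) (x : X) :
    M.vlim α x ≤ M.infValue α x :=
  iSup_le fun n => le_iInf fun π =>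
    (M.viter_le_finCost hXc hh α n π x).trans (M.finCost_le_infCost α n π x)

end Model

/-! ### Preservation of `K`-convexity. -/

/-- Scarf's `K`-convexity for functions on the state space. -/
def KConvex {X : AddSubgroup ℝ} (K : ℝ) (g : X → ℝ) : Prop :=
  ∀ (x y z : X) (l : ℝ), 0 ≤ l → l ≤ 1 → x ≤ y → (z : ℝ) = (1 - l) * x + l * y →
    g z ≤ (1 - l) * g x + l * (g y + K)

/-- `K`-convexity for functions with values in `[0, ∞]`. -/
def EKConvex {X : AddSubgroup ℝ} (K : ℝ) (w : X → ℝ≥0∞) : Prop :=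
  ∀ (x y z : X) (l : ℝ), 0 ≤ l → l ≤ 1 → x ≤ y → (z : ℝ) = (1 - l) * x + l * y →
    w z ≤ ENNReal.ofReal (1 - l) * w x + ENNReal.ofReal l * (w y + ENNReal.ofReal K)

namespace Model

variable {X : AddSubgroup ℝ} {Ω : Type*} [MeasurableSpace Ω] {P : Measure Ω}
  [IsProbabilityMeasure P] (M : Model X P)

/-- The linear term satisfies the inequality with equality and cancels. Expectations can thus be
treated in `[0, ∞]` and the ordering step in terms of the real function `G`. -/
lemma eKConvex_iff {w : X → ℝ≥0∞} (hw : ∀ y, w y ≠ ⊤) :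
    EKConvex M.K w ↔ KConvex M.K (M.gfun w) := by
  have key : ∀ (x y z : X) (l : ℝ), 0 ≤ l → l ≤ 1 → (z : ℝ) = (1 - l) * x + l * y →
      (w z ≤ ENNReal.ofReal (1 - l) * w x + ENNReal.ofReal l * (w y + ENNReal.ofReal M.K) ↔
        M.gfun w z ≤ (1 - l) * M.gfun w x + l * (M.gfun w y + M.K)) := by
    intro x y z l h0 h1 hz
    have h1' : 0 ≤ 1 - l := by linarith
    have hK := M.K_pos.le
    have hx := hw x
    have hy := hw y
    rw [← ENNReal.toReal_le_toReal (hw z) (by finiteness),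
      ENNReal.toReal_add (by finiteness) (by finiteness), ENNReal.toReal_mul, ENNReal.toReal_mul,
      ENNReal.toReal_add (by finiteness) (by finiteness), ENNReal.toReal_ofReal h0,
      ENNReal.toReal_ofReal h1', ENNReal.toReal_ofReal hK]
    unfold gfun
    rw [hz]
    constructor <;> intro h <;> linarith
  exact ⟨fun h x y z l h0 h1 hxy hz => (key x y z l h0 h1 hz).1 (h x y z l h0 h1 hxy hz),
    fun h x y z l h0 h1 hxy hz => (key x y z l h0 h1 hz).2 (h x y z l h0 h1 hxy hz)⟩

lemma setup_le (a : Act X) : M.setup a ≤ M.K := by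
  unfold setup; split_ifs; exacts [le_rfl, M.K_pos.le]

lemma bellman_ne_top {w : X → ℝ≥0∞} (hw : ∀ y, w y ≠ ⊤) (x : X) : M.bellman w x ≠ ⊤ :=
  ne_top_of_le_ne_top (M.qval_ne_top hw x ⟨0, le_rfl⟩) (iInf_le _ _)

lemma gfun_bellman_le {w : X → ℝ≥0∞} (hw : ∀ y, w y ≠ ⊤) (x : X) (a : Act X) :
    M.gfun (M.bellman w) x ≤ M.setup a + M.gfun w (x + (a : X)) := by
  have h := ENNReal.toReal_mono (M.qval_ne_top hw x a) (iInf_le (M.qval w x) a)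
  rw [M.toReal_qval hw] at h
  unfold gfun at h ⊢
  unfold bellman
  linarith

lemma exists_gfun_bellman_eq (hXc : IsClosed (X : Set ℝ)) {w : X → ℝ≥0∞} (hw : ∀ y, w y ≠ ⊤)
    (hlsc : LowerSemicontinuous w) (x : X) :
    ∃ a : Act X, M.gfun (M.bellman w) x = M.setup a + M.gfun w (x + (a : X)) := by
  obtain ⟨a, ha⟩ := M.exists_qval_eq_bellman hXc hlsc x
  refine ⟨a, ?_⟩
  have h := M.toReal_qval hw x a
  rw [ha] at h
  have h2 : M.gfun (M.bellman w) x = M.c * x + (M.bellman w x).toReal := rfl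
  rw [h2, h]
  ring

/-- Write `G*` for the new function. Always `G*(z) ≤ G*(y) + K`, which settles the case `G*(z) ≤
G*(x)`. Otherwise the optimal level `x + a` lies below `z`, since `z` could otherwise order up to it
at no greater cost, and `K`-convexity of `G` applies between `x + a` and `y + b`. -/
lemma kConvex_gfun_bellman (hXc : IsClosed (X : Set ℝ)) {w : X → ℝ≥0∞} (hw : ∀ y, w y ≠ ⊤)
    (hlsc : LowerSemicontinuous w) (hK : KConvex M.K (M.gfun w)) :
    KConvex M.K (M.gfun (M.bellman w)) := by
  intro x y z l h0 h1 hxy hz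
  have hKpos := M.K_pos
  have hxy' : (x : ℝ) ≤ y := hxy
  have hxz : x ≤ z := show (x : ℝ) ≤ z by nlinarith
  have hzy : z ≤ y := show (z : ℝ) ≤ y by nlinarith
  obtain ⟨a, ha⟩ := M.exists_gfun_bellman_eq hXc hw hlsc x
  obtain ⟨b, hb⟩ := M.exists_gfun_bellman_eq hXc hw hlsc y
  have hord : ∀ u, z ≤ u → M.gfun (M.bellman w) z ≤ M.K + M.gfun w u := by
    intro u hu
    have h := M.gfun_bellman_le hw z ⟨u - z, sub_nonneg.2 hu⟩
    have h' := M.setup_le (⟨u - z, sub_nonneg.2 hu⟩ : Act X)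
    simp only [add_sub_cancel] at h
    linarith
  have hno : M.gfun (M.bellman w) z ≤ M.gfun w z := by
    simpa [setup] using M.gfun_bellman_le hw z ⟨0, le_rfl⟩
  have hy' : y ≤ y + (b : X) := le_add_of_nonneg_right b.2
  have hx' : x ≤ x + (a : X) := le_add_of_nonneg_right a.2
  have hzK : M.gfun (M.bellman w) z ≤ M.gfun (M.bellman w) y + M.K := by
    have := hord _ (hzy.trans hy')
    have := M.setup_nonneg b
    linarith
  by_cases hcase : M.gfun (M.bellman w) z ≤ M.gfun (M.bellman w) x
  · nlinarith
  push Not at hcase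
  have hlt : x + (a : X) < z := by
    by_contra! hge
    rcases eq_or_lt_of_le hge with heq | hgt
    · have := M.setup_nonneg a
      rw [← heq] at ha
      linarith
    · have hpos : 0 < (a : X) := (lt_add_iff_pos_right x).1 (hxz.trans_lt hgt)
      have := hord _ hge
      simp only [setup, hpos, if_true] at ha
      linarith
  obtain ⟨m, hm0, hm1, hzm, hm⟩ :=
    exists_convexComb hlt.le (hzy.trans hy') (hlt.trans_le (hzy.trans hy'))
  have hconv := hK _ _ _ m hm0 hm1 (hlt.le.trans (hzy.trans hy')) hzm
  -- Moving both endpoints to the right lowers the relative position of `z`.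
  have hml : m ≤ l := by
    have h2 : ((x + (a : X) : X) : ℝ) < (y + (b : X) : X) := hlt.trans_le (hzy.trans hy')
    have h3 : (x : ℝ) ≤ (x + (a : X) : X) := hx'
    have h4 : (y : ℝ) ≤ (y + (b : X) : X) := hy'
    rw [hm, div_le_iff₀ (sub_pos.2 h2), hz]
    nlinarith
  have hsa := M.setup_nonneg a
  have hsb := M.setup_nonneg b
  have e1 : M.gfun w (x + (a : X)) ≤ M.gfun (M.bellman w) x := by linarith
  have e2 : M.gfun w (y + (b : X)) ≤ M.gfun (M.bellman w) y := by linarith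
  -- Since `G*(x) < G*(z) ≤ G*(y) + K`, the bound increases with the weight, and `m` may be replaced
  -- by `l`.
  nlinarith

lemma measurable_comp_sub {v : X → ℝ≥0∞} (hv : Measurable v) (x : X) :
    Measurable fun ω => v (x - M.D 0 ω) :=
  hv.comp (measurable_const.sub (M.D_measurable 0))

lemma eKConvex_lintegral {v : X → ℝ≥0∞} (hv : Measurable v) {K : ℝ} (hK : EKConvex K v) :
    EKConvex K (fun y => ∫⁻ ω, v (y - M.D 0 ω) ∂P) := by
  intro x y z l h0 h1 hxy hz
  calc ∫⁻ ω, v (z - M.D 0 ω) ∂P ≤ ∫⁻ ω, (ENNReal.ofReal (1 - l) * v (x - M.D 0 ω)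
        + ENNReal.ofReal l * (v (y - M.D 0 ω) + ENNReal.ofReal K)) ∂P := by
        refine lintegral_mono fun ω => hK _ _ _ l h0 h1 (sub_le_sub_right hxy _) ?_
        simp only [AddSubgroup.coe_sub, hz]
        ring
    _ = _ := by
        have hm : Measurable fun ω => v (y - M.D 0 ω) + ENNReal.ofReal K :=
          (M.measurable_comp_sub hv y).add measurable_const
        rw [lintegral_add_left ((M.measurable_comp_sub hv x).const_mul _),
          lintegral_const_mul _ (M.measurable_comp_sub hv x),
          lintegral_const_mul _ hm, lintegral_add_right _ measurable_const]
        simp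

lemma eKConvex_expHold (hh : Continuous M.h) : EKConvex 0 M.expHold := by
  refine M.eKConvex_lintegral (v := fun x => ENNReal.ofReal (M.h x)) hh.measurable.ennreal_ofReal ?_
  intro x y z l h0 h1 hxy hz
  have h1' : 0 ≤ 1 - l := by linarith
  have hx := M.h_nonneg x
  have hy := M.h_nonneg y
  rw [ENNReal.ofReal_zero, add_zero, ← ENNReal.ofReal_mul h1', ← ENNReal.ofReal_mul h0,
    ← ENNReal.ofReal_add (by positivity) (by positivity)]
  exact ENNReal.ofReal_le_ofReal (M.h_convex x y z l h0 h1 hz)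

lemma eKConvex_post (hh : Continuous M.h) {α : ℝ} (hα1 : α < 1) {v : X → ℝ≥0∞}
    (hv : Measurable v) (hK : EKConvex M.K v) : EKConvex M.K (M.post α v) := by
  intro x y z l h0 h1 hxy hz
  have hα' : ENNReal.ofReal α ≤ 1 := by simpa using hα1.le
  have e1 := M.eKConvex_expHold hh x y z l h0 h1 hxy hz
  have e2 := M.eKConvex_lintegral hv hK x y z l h0 h1 hxy hz
  simp only [ENNReal.ofReal_zero, add_zero] at e1 e2
  set I := fun y => ∫⁻ ω, v (y - M.D 0 ω) ∂P
  calc M.post α v z ≤ (ENNReal.ofReal (1 - l) * M.expHold x + ENNReal.ofReal l * M.expHold y)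
        + ENNReal.ofReal α * (ENNReal.ofReal (1 - l) * I x
          + ENNReal.ofReal l * (I y + ENNReal.ofReal M.K)) := by
          unfold post; gcongr
    _ = ENNReal.ofReal (1 - l) * (M.expHold x + ENNReal.ofReal α * I x)
        + ENNReal.ofReal l * ((M.expHold y + ENNReal.ofReal α * I y)
          + ENNReal.ofReal α * ENNReal.ofReal M.K) := by ring
    _ ≤ ENNReal.ofReal (1 - l) * (M.expHold x + ENNReal.ofReal α * I x)
        + ENNReal.ofReal l * ((M.expHold y + ENNReal.ofReal α * I y)
          + 1 * ENNReal.ofReal M.K) := by gcongr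
    _ = _ := by rw [one_mul]; rfl

lemma eKConvex_viter (hXc : IsClosed (X : Set ℝ)) (hh : Continuous M.h) {α : ℝ}
    (hα0 : 0 ≤ α) (hα1 : α < 1) (n : ℕ) : EKConvex M.K (M.viter α n) := by
  induction n with
  | zero => intro x y z l _ _ _ _; exact zero_le
  | succ n ih =>
    have hlsc := M.lowerSemicontinuous_viter hXc hh α n
    have hfin := M.post_viter_ne_top hh hα0 hα1 n
    have hp := (M.eKConvex_iff hfin).1 (M.eKConvex_post hh hα1 hlsc.measurable ih)
    exact (M.eKConvex_iff (M.bellman_ne_top hfin)).2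
      (M.kConvex_gfun_bellman hXc hfin (M.lowerSemicontinuous_post hh α hlsc) hp)

lemma eKConvex_vlim (hXc : IsClosed (X : Set ℝ)) (hh : Continuous M.h) {α : ℝ}
    (hα0 : 0 ≤ α) (hα1 : α < 1) : EKConvex M.K (M.vlim α) := by
  intro x y z l h0 h1 hxy hz
  refine iSup_le fun n => (M.eKConvex_viter hXc hh hα0 hα1 n x y z l h0 h1 hxy hz).trans ?_
  gcongr <;> exact M.viter_le_vlim α n _

lemma lowerSemicontinuous_vlim (hXc : IsClosed (X : Set ℝ)) (hh : Continuous M.h) (α : ℝ) :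
    LowerSemicontinuous (M.vlim α) :=
  lowerSemicontinuous_iSup fun n => M.lowerSemicontinuous_viter hXc hh α n

lemma kConvex_gfun_post_vlim (hXc : IsClosed (X : Set ℝ)) (hh : Continuous M.h) {α : ℝ}
    (hα0 : 0 ≤ α) (hα1 : α < 1) : KConvex M.K (M.gfun (M.post α (M.vlim α))) :=
  (M.eKConvex_iff (M.post_vlim_ne_top hh hα0 hα1)).1
    (M.eKConvex_post hh hα1 (M.lowerSemicontinuous_vlim hXc hh α).measurable
      (M.eKConvex_vlim hXc hh hα0 hα1))

/-! ### The limit of value iteration and verification of `(s, S)` policies. -/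

lemma post_vlim_eq (hXc : IsClosed (X : Set ℝ)) (hh : Continuous M.h) (α : ℝ) (y : X) :
    M.post α (M.vlim α) y = ⨆ n, M.post α (M.viter α n) y := by
  unfold post vlim
  rw [lintegral_iSup
    (fun n => M.measurable_comp_sub (M.lowerSemicontinuous_viter hXc hh α n).measurable y)
    (fun m n hmn ω => M.viter_mono α hmn _), ENNReal.mul_iSup, ENNReal.add_iSup]

/-- The limit of value iteration is a supersolution of the optimality equation. -/
lemma exists_qval_post_vlim_le (hXc : IsClosed (X : Set ℝ)) (hh : Continuous M.h) {α : ℝ}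
    (hα0 : 0 ≤ α) (hα1 : α < 1) (x : X) :
    ∃ a, M.qval (M.post α (M.vlim α)) x a ≤ M.vlim α x := by
  have hlsc : ∀ n, LowerSemicontinuous (M.post α (M.viter α n)) := fun n =>
    M.lowerSemicontinuous_post hh α (M.lowerSemicontinuous_viter hXc hh α n)
  have hfin := M.vlim_ne_top hh hα0 hα1 x
  -- The orders of cost at most `vlim α x` for the `n`-th cost-to-go form decreasing nonempty
  -- compact sets; a common element serves all `n` at once.
  obtain ⟨a, ha⟩ := IsCompact.nonempty_iInter_of_sequence_nonempty_isCompact_isClosed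
    (fun n => {a | M.qval (M.post α (M.viter α n)) x a ≤ M.vlim α x})
    (fun n a ha => by
      refine le_trans ?_ (show M.qval (M.post α (M.viter α (n + 1))) x a ≤ _ from ha)
      unfold qval
      gcongr
      exact M.post_mono α (M.viter_mono α n.le_succ) _)
    (fun n => by
      obtain ⟨a, ha⟩ := M.exists_qval_eq_bellman hXc (hlsc n) x
      exact ⟨a, ha.trans_le (M.viter_le_vlim α (n + 1) x)⟩)
    (M.isCompact_qval_le hXc (hlsc 0) x hfin)
    (fun n => (M.lowerSemicontinuous_qval_right (hlsc n) x).isClosed_preimage _)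
  refine ⟨a, ?_⟩
  rw [qval, M.post_vlim_eq hXc hh, ENNReal.add_iSup]
  exact iSup_le fun n => Set.mem_iInter.1 ha n

/-- For a `K`-convex function the `(s, S)` decisions minimize the cost of ordering. -/
lemma qval_sSAction_le {w : X → ℝ≥0∞} (hw : ∀ y, w y ≠ ⊤) (hK : KConvex M.K (M.gfun w))
    {s S : X} (hsS : s ≤ S) (hS : ∀ y, M.gfun w S ≤ M.gfun w y)
    (hs : M.gfun w s ≤ M.K + M.gfun w S) (hlow : ∀ x < s, M.K + M.gfun w S ≤ M.gfun w x)
    (x : X) (a : Act X) : M.qval w x (sSAction s S hsS x) ≤ M.qval w x a := by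
  rw [M.qval_le_qval_iff hw]
  have hKpos := M.K_pos
  have hSa := hS (x + (a : X))
  by_cases hx : x < s
  · have h1 := M.setup_le (⟨S - x, sub_nonneg.2 (hx.le.trans hsS)⟩ : Act X)
    have h2 := hlow x hx
    simp only [sSAction, hx, dif_pos, add_sub_cancel]
    rcases eq_or_lt_of_le a.2 with h0 | h0
    · simp only [setup, ← h0, lt_irrefl, if_false, add_zero, zero_add] at h1 ⊢
      linarith
    · have h3 : M.setup a = M.K := by simp [setup, h0]
      linarith
  · have h1 : M.setup (sSAction s S hsS x) + M.gfun w (x + (sSAction s S hsS x : X))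
        = M.gfun w x := by simp [sSAction, hx, setup]
    rw [h1]
    push Not at hx
    rcases eq_or_lt_of_le a.2 with h0 | h0
    · simp [setup, ← h0]
    have h3 : M.setup a = M.K := by simp [setup, h0]
    rw [h3]
    -- On `[s, S]`, `K`-convexity between `s` and `S` gives `G(x) ≤ K + G(S)`. To the right of `S`
    -- it is applied between `S` and `x + a`. Either way an order does not pay.
    rcases le_or_gt x S with hxS | hxS
    · rcases eq_or_lt_of_le hsS with rfl | hlt
      · obtain rfl := le_antisymm hxS hx
        linarith
      · obtain ⟨l, hl0, hl1, hl, -⟩ := exists_convexComb hx hxS hlt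
        have := hK s S x l hl0 hl1 hsS hl
        nlinarith
    · have hlt : x < x + (a : X) := lt_add_of_pos_right _ h0
      obtain ⟨l, hl0, hl1, hl, -⟩ := exists_convexComb hxS.le hlt.le (hxS.trans hlt)
      have := hK S _ x l hl0 hl1 (hxS.le.trans hlt.le) hl
      nlinarith

/-- Verification: an `(s, S)` policy whose parameters fit the limit of value iteration is optimal,
and its cost is the limit of value iteration. -/
theorem infCost_sSPolicy_le (hXc : IsClosed (X : Set ℝ)) (hh : Continuous M.h) {α : ℝ}
    (hα0 : 0 ≤ α) (hα1 : α < 1) {s S : X} (hsS : s ≤ S)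
    (hS : ∀ y, M.gfun (M.post α (M.vlim α)) S ≤ M.gfun (M.post α (M.vlim α)) y)
    (hs : M.gfun (M.post α (M.vlim α)) s ≤ M.K + M.gfun (M.post α (M.vlim α)) S)
    (hlow : ∀ x < s, M.K + M.gfun (M.post α (M.vlim α)) S ≤ M.gfun (M.post α (M.vlim α)) x)
    (x : X) : M.infCost α (sSPolicy s S hsS) x ≤ M.vlim α x := by
  refine M.infCost_stationary_le hh _ (M.lowerSemicontinuous_vlim hXc hh α).measurable
    (fun x => ?_) x
  obtain ⟨a, ha⟩ := M.exists_qval_post_vlim_le hXc hh hα0 hα1 x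
  exact (M.qval_sSAction_le (M.post_vlim_ne_top hh hα0 hα1)
    (M.kConvex_gfun_post_vlim hXc hh hα0 hα1) hsS hS hs hlow x a).trans ha

/-! ### Slopes of `h` at `-∞`, `k_h` and `α*`. -/

include M in
lemma exists_pos : ∃ d : X, 0 < d := by
  by_contra! h
  have : {ω | 0 < M.D 0 ω} = ∅ := Set.eq_empty_of_forall_notMem fun ω hω => (h _).not_gt hω
  have h2 := M.D_pos
  rw [this, measure_empty] at h2
  exact h2.false

include M in
lemma tendsto_coe_atBot : Tendsto ((↑) : X → ℝ) atBot atBot := by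
  obtain ⟨d, hd⟩ := M.exists_pos
  have hd' : (0 : ℝ) < d := hd
  refine tendsto_atBot_atBot.2 fun b => ?_
  obtain ⟨n, hn⟩ := exists_nat_gt (-b / (d : ℝ))
  refine ⟨-(n • d), fun a ha => ?_⟩
  have h1 : (a : ℝ) ≤ -(n * (d : ℝ)) := by
    have : (a : ℝ) ≤ ((-(n • d) : X) : ℝ) := ha
    simpa using this
  rw [div_lt_iff₀ hd'] at hn
  linarith

include M in
lemma eventually_neg : ∀ᶠ x : X in atBot, x < 0 :=
  (M.tendsto_coe_atBot.eventually (eventually_lt_atBot 0)).mono fun _ hx => hx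

/-- Convexity with `h(0) = 0`. Hence the limit defining `k_h` exists and is a supremum. -/
lemma h_ratio_le {x x₀ : X} (hx₀ : x₀ < 0) (hx : x ≤ x₀) :
    M.h x₀ / (-(x₀ : ℝ)) ≤ M.h x / (-(x : ℝ)) := by
  have h1 : (x₀ : ℝ) < 0 := hx₀
  have h2 : (x : ℝ) ≤ x₀ := hx
  obtain ⟨l, h0, h1', hl, -⟩ := exists_convexComb hx hx₀.le (hx.trans_lt hx₀)
  have h3 := M.h_convex x 0 x₀ l h0 h1' hl
  simp only [M.h_zero, mul_zero, add_zero, AddSubgroup.coe_zero] at h3 hl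
  rw [div_le_div_iff₀ (by linarith) (by linarith)]
  have h4 := M.h_nonneg x
  rw [hl]
  nlinarith

lemma kh_eq_iSup : M.kh = ⨆ x : {x : X // x < 0}, ((M.h x / (-((x : X) : ℝ)) : ℝ) : EReal) := by
  set k : EReal := ⨆ x : {x : X // x < 0}, ((M.h x / (-((x : X) : ℝ)) : ℝ) : EReal) with hk
  have hneg : ∀ x : X, ((M.h x / (x : ℝ) : ℝ) : EReal)
      = -((M.h x / (-(x : ℝ)) : ℝ) : EReal) := fun x => by
    rw [div_neg, ← EReal.coe_neg, neg_neg]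
  have : Tendsto (fun x : X => ((M.h x / (x : ℝ) : ℝ) : EReal)) atBot (𝓝 (-k)) := by
    refine tendsto_order.2 ⟨fun a ha => ?_, fun a ha => ?_⟩
    · filter_upwards [M.eventually_neg] with x hx
      rw [hneg, EReal.lt_neg_comm]
      exact (le_iSup (fun x : {x : X // x < 0} =>
        ((M.h x / (-((x : X) : ℝ)) : ℝ) : EReal)) ⟨x, hx⟩).trans_lt (EReal.lt_neg_comm.1 ha)
    · obtain ⟨⟨x₀, hx₀⟩, h⟩ := lt_iSup_iff.1 (EReal.neg_lt_comm.1 ha)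
      filter_upwards [eventually_le_atBot x₀] with x hx
      rw [hneg, EReal.neg_lt_comm]
      exact h.trans_le (EReal.coe_le_coe_iff.2 (M.h_ratio_le hx₀ hx))
  rw [kh, this.limUnder_eq, neg_neg]

lemma lt_kh_iff (q : ℝ) : (q : EReal) < M.kh ↔ ∃ x : X, x < 0 ∧ q * (-(x : ℝ)) < M.h x := by
  rw [M.kh_eq_iSup, lt_iSup_iff, Subtype.exists]
  refine exists_congr fun x => ?_
  have key : ∀ hx : x < 0, (q : EReal) < ((M.h x / (-(x : ℝ)) : ℝ) : EReal)
      ↔ q * (-(x : ℝ)) < M.h x := fun hx => by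
    have h1 : (x : ℝ) < 0 := hx
    rw [EReal.coe_lt_coe_iff, lt_div_iff₀ (by linarith)]
  exact ⟨fun ⟨hx, h⟩ => ⟨hx, (key hx).1 h⟩, fun ⟨hx, h⟩ => ⟨hx, (key hx).2 h⟩⟩

/-- Replaces extended-real arithmetic by a single state that witnesses the slope, the form in which
both parts of the theorem use `α*`. -/
lemma alphaStar_lt_iff (α : ℝ) :
    M.alphaStar < (α : EReal) ↔ ∃ x : X, x < 0 ∧ (1 - α) * M.c * (-(x : ℝ)) < M.h x := by
  rw [← M.lt_kh_iff, alphaStar]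
  have hc := M.c_pos
  have hc' : (0 : EReal) < (M.c : EReal) := EReal.coe_pos.2 hc
  induction M.kh with
  | bot =>
    rw [EReal.bot_div_of_pos_ne_top hc' (EReal.coe_ne_top _), ← EReal.coe_one, EReal.coe_sub_bot]
    simp only [not_top_lt, not_lt_bot]
  | top =>
    rw [EReal.top_div_of_pos_ne_top hc' (EReal.coe_ne_top _), EReal.sub_top]
    exact iff_of_true (EReal.bot_lt_coe _) (EReal.coe_lt_top _)
  | coe k =>
    rw [← EReal.coe_div, ← EReal.coe_one, ← EReal.coe_sub, EReal.coe_lt_coe_iff,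
      EReal.coe_lt_coe_iff, sub_lt_comm, lt_div_iff₀ hc]

/-! ### Coercivity of `G_t` at `-∞` and the index `N_α`. -/

/-- Left of `x₀` the ratio `h(x) / (-x)` is at least `q`; right of `x₀` the linear function is
negative. -/
lemma mul_sub_le_h {q : ℝ} (hq : 0 ≤ q) {x₀ : X} (hx₀ : x₀ < 0) (h : q * (-(x₀ : ℝ)) ≤ M.h x₀)
    (x : X) : q * ((x₀ : ℝ) - x) ≤ M.h x := by
  have h0 : (x₀ : ℝ) < 0 := hx₀
  rcases le_or_gt x x₀ with hx | hx
  · have h1 := M.h_ratio_le hx₀ hx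
    have h2 : (x : ℝ) ≤ x₀ := hx
    have h3 : q ≤ M.h x₀ / (-(x₀ : ℝ)) := (le_div_iff₀ (by linarith)).2 h
    have h4 := (le_div_iff₀ (by linarith : 0 < -(x : ℝ))).1 (h3.trans h1)
    nlinarith
  · have h2 : (x₀ : ℝ) < x := hx
    nlinarith [M.h_nonneg x]

lemma ofReal_le_expHold {q b : ℝ} (hq : 0 ≤ q) (hb : ∀ x : X, q * (b - x) ≤ M.h x) (y : X) :
    ENNReal.ofReal (q * (b - y)) ≤ M.expHold y := by
  calc ENNReal.ofReal (q * (b - y)) = ∫⁻ _, ENNReal.ofReal (q * (b - y)) ∂P := by simp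
    _ ≤ _ := by
      refine lintegral_mono_ae ?_
      filter_upwards [M.D_nonneg 0] with ω hω
      have h2 : (0 : ℝ) ≤ M.D 0 ω := hω
      have h3 := hb (y - M.D 0 ω)
      rw [AddSubgroup.coe_sub] at h3
      exact ENNReal.ofReal_le_ofReal (by nlinarith)

/-- Demand is nonnegative, so a decreasing linear minorant passes through the expectation without a
correction. -/
lemma ofReal_le_post {α : ℝ} (hα0 : 0 ≤ α) {q b : ℝ} (hq : 0 ≤ q)
    (hb : ∀ x : X, q * (b - x) ≤ M.h x) {v : X → ℝ≥0∞} {p C : ℝ} (hp : 0 ≤ p)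
    (hv : ∀ x : X, ENNReal.ofReal (-p * x - C) ≤ v x) (y : X) :
    ENNReal.ofReal (-(q + α * p) * y - (α * C - q * b)) ≤ M.post α v y := by
  have h1 : ENNReal.ofReal (-p * y - C) ≤ ∫⁻ ω, v (y - M.D 0 ω) ∂P := by
    calc ENNReal.ofReal (-p * y - C) = ∫⁻ _, ENNReal.ofReal (-p * y - C) ∂P := by simp
      _ ≤ _ := by
        refine lintegral_mono_ae ?_
        filter_upwards [M.D_nonneg 0] with ω hω
        have h2 : (0 : ℝ) ≤ M.D 0 ω := hω
        refine le_trans (ENNReal.ofReal_le_ofReal ?_) (hv _)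
        rw [AddSubgroup.coe_sub]
        nlinarith
  calc ENNReal.ofReal (-(q + α * p) * y - (α * C - q * b))
      = ENNReal.ofReal (q * (b - y) + α * (-p * y - C)) := by congr 1; ring
    _ ≤ ENNReal.ofReal (q * (b - y)) + ENNReal.ofReal (α * (-p * y - C)) :=
        ENNReal.ofReal_add_le
    _ ≤ M.post α v y := by
        rw [ENNReal.ofReal_mul hα0]
        unfold post
        gcongr
        exact M.ofReal_le_expHold hq hb y

/-- One unit ordered costs `c` and lowers the minorant by only `p ≤ c`. -/
lemma ofReal_le_bellman {w : X → ℝ≥0∞} {p C : ℝ} (hpc : p ≤ M.c)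
    (hw : ∀ y : X, ENNReal.ofReal (-p * y - C) ≤ w y) (x : X) :
    ENNReal.ofReal (-p * x - C) ≤ M.bellman w x := by
  refine le_iInf fun a => ?_
  have ha : (0 : ℝ) ≤ ((a : X) : ℝ) := a.2
  calc ENNReal.ofReal (-p * x - C)
      ≤ ENNReal.ofReal (M.c * ((a : X) : ℝ) + (-p * (x + (a : X) : X) - C)) := by
        refine ENNReal.ofReal_le_ofReal ?_
        rw [AddSubgroup.coe_add]
        nlinarith
    _ ≤ ENNReal.ofReal (M.c * ((a : X) : ℝ)) + ENNReal.ofReal (-p * (x + (a : X) : X) - C) :=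
        ENNReal.ofReal_add_le
    _ ≤ M.qval w x a := by
        unfold qval orderCost
        gcongr
        · exact le_add_self
        · exact hw _

/-- Asymptotic slope of the value iterates at `-∞`. -/
lemma exists_slope_viter {α : ℝ} (hα0 : 0 ≤ α) {q b : ℝ} (hq : 0 ≤ q)
    (hqα : (1 - α) * M.c < q) (hb : ∀ x : X, q * (b - x) ≤ M.h x) (N : ℕ) :
    ∃ p C : ℝ, 0 ≤ p ∧ min M.c (q * ∑ i ∈ Finset.range N, α ^ i) ≤ p ∧
      ∀ x : X, ENNReal.ofReal (-p * x - C) ≤ M.viter α N x := by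
  have hc := M.c_pos
  induction N with
  | zero => exact ⟨0, 0, le_rfl, by simp, fun x => by simp⟩
  | succ N ih =>
    obtain ⟨p, C, hp0, hp, hv⟩ := ih
    have hpost := fun y => M.ofReal_le_post hα0 hq hb hp0 hv y
    set r := q + α * p
    set C' := α * C - q * b
    have hr0 : 0 ≤ r := by positivity
    have hr : min M.c (q * ∑ i ∈ Finset.range (N + 1), α ^ i) ≤ r := by
      rw [geom_sum_succ]
      -- If `p ≥ c`, then `q + α p ≥ (1 - α) c + α c = c`; otherwise the geometric sum gains a term.
      rcases min_le_iff.1 hp with h | h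
      · exact (min_le_left _ _).trans (by simp only [r]; nlinarith)
      · exact (min_le_right _ _).trans (by simp only [r]; nlinarith)
    rcases le_or_gt r M.c with hrc | hrc
    · exact ⟨r, C', hr0, hr, M.ofReal_le_bellman hrc hpost⟩
    -- A slope above `c` is not preserved by ordering, so the minorant is scaled by `c / r < 1`.
    -- This keeps it a minorant because `ENNReal.ofReal` truncates negative values to `0`.
    · have hrpos : 0 < r := hc.trans hrc
      refine ⟨M.c, M.c / r * C', hc.le, min_le_left _ _,
        M.ofReal_le_bellman le_rfl fun y => le_trans ?_ (hpost y)⟩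
      have e : -M.c * (y : ℝ) - M.c / r * C' = M.c / r * (-r * y - C') := by field_simp
      rw [e]
      rcases le_or_gt 0 (-r * (y : ℝ) - C') with h | h
      · exact ENNReal.ofReal_le_ofReal
          (mul_le_of_le_one_left h ((div_le_one hrpos).2 hrc.le))
      · rw [ENNReal.ofReal_of_nonpos (mul_nonpos_of_nonneg_of_nonpos (by positivity) h.le)]
        exact zero_le

lemma lt_of_lt_mul_geom_sum {α c q : ℝ} (hα0 : 0 ≤ α) (hα1 : α < 1) (hq : 0 ≤ q) {n : ℕ}
    (h : c < q * ∑ i ∈ Finset.range n, α ^ i) : (1 - α) * c < q := by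
  have h1 := mul_neg_geom_sum α n
  have h2 : 0 ≤ α ^ n := pow_nonneg hα0 n
  have h3 : 0 < 1 - α := by linarith
  nlinarith [mul_lt_mul_of_pos_left h h3]

/-- Coercivity at `-∞`. -/
lemma exists_coercive (hh : Continuous M.h) {α : ℝ} (hα0 : 0 ≤ α) (hα1 : α < 1) {q b : ℝ}
    (hq : 0 ≤ q) (hb : ∀ x : X, q * (b - x) ≤ M.h x) {N : ℕ}
    (hN : M.c < q * ∑ i ∈ Finset.range (N + 1), α ^ i) :
    ∃ δ C : ℝ, 0 < δ ∧ ∀ y : X, δ * (-(y : ℝ)) - C ≤ M.gfun (M.post α (M.viter α N)) y := by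
  have hqα := lt_of_lt_mul_geom_sum hα0 hα1 hq hN
  obtain ⟨p, C, hp0, hp, hv⟩ := M.exists_slope_viter hα0 hq hqα hb N
  have hpost := fun y => M.ofReal_le_post hα0 hq hb hp0 hv y
  refine ⟨q + α * p - M.c, α * C - q * b, ?_, fun y => ?_⟩
  · rw [geom_sum_succ] at hN
    rcases min_le_iff.1 hp with h | h <;> nlinarith
  · have h1 := (ENNReal.ofReal_le_iff_le_toReal (M.post_viter_ne_top hh hα0 hα1 N y)).1 (hpost y)
    unfold gfun
    linarith

lemma ae_nonneg_all : ∀ᵐ ω ∂P, ∀ t, 0 ≤ M.D t ω := ae_all_iff.2 M.D_nonneg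

lemma ofReal_pow_sum {α : ℝ} (hα0 : 0 ≤ α) (n : ℕ) :
    ∑ i ∈ Finset.range n, ENNReal.ofReal α ^ i
      = ENNReal.ofReal (∑ i ∈ Finset.range n, α ^ i) := by
  rw [ENNReal.ofReal_sum_of_nonneg fun i _ => pow_nonneg hα0 i]
  exact Finset.sum_congr rfl fun i _ => (ENNReal.ofReal_pow hα0 i).symm

/-- Each summand is at least `α^i q (b - x)`, so the total slope `q σ` beats `c`. `not_tendsto_fFun`
is the converse. -/
lemma tendsto_fFun {α : ℝ} (hα0 : 0 ≤ α) {q b : ℝ}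
    (hq : 0 ≤ q) (hb : ∀ x : X, q * (b - x) ≤ M.h x) {t : ℕ}
    (ht : M.c < q * ∑ i ∈ Finset.range (t + 1), α ^ i) :
    Tendsto (M.fFun α t) atBot (𝓝 ⊤) := by
  set σ := ∑ i ∈ Finset.range (t + 1), α ^ i
  have hσ : 0 ≤ σ := Finset.sum_nonneg fun i _ => pow_nonneg hα0 i
  have hreal : Tendsto (fun x : X => (q * σ - M.c) * (-(x : ℝ)) + σ * q * b) atBot atTop :=
    tendsto_atTop_add_const_right _ _
      ((tendsto_neg_atBot_atTop.comp M.tendsto_coe_atBot).const_mul_atTop (by linarith))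
  refine tendsto_nhds_top_mono (EReal.tendsto_coe_nhds_top_iff.2 hreal)
    (Eventually.of_forall fun x => ?_)
  have h1 : ENNReal.ofReal (σ * (q * (b - x))) ≤ ∑ i ∈ Finset.range (t + 1), ENNReal.ofReal α ^ i *
      ∫⁻ ω, ENNReal.ofReal (M.h (x - ∑ j ∈ Finset.range (i + 1), M.D j ω)) ∂P := by
    rw [ENNReal.ofReal_mul hσ, ← ofReal_pow_sum hα0, Finset.sum_mul]
    refine Finset.sum_le_sum fun i _ => ?_
    gcongr
    calc ENNReal.ofReal (q * (b - x)) = ∫⁻ _, ENNReal.ofReal (q * (b - x)) ∂P := by simp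
      _ ≤ _ := by
        refine lintegral_mono_ae ?_
        filter_upwards [M.ae_nonneg_all] with ω hω
        have h2 : (0 : ℝ) ≤ (∑ j ∈ Finset.range (i + 1), M.D j ω : X) :=
          Finset.sum_nonneg fun j _ => hω j
        have h3 := hb (x - ∑ j ∈ Finset.range (i + 1), M.D j ω)
        rw [AddSubgroup.coe_sub] at h3
        exact ENNReal.ofReal_le_ofReal (by nlinarith)
  have h2 : ((q * σ - M.c) * (-(x : ℝ)) + σ * q * b : ℝ) = M.c * (x : ℝ) + σ * (q * (b - x)) := by
    ring
  beta_reduce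
  rw [h2, EReal.coe_add, fFun]
  refine add_le_add le_rfl (le_trans ?_ (EReal.coe_ennreal_le_coe_ennreal_iff.2 h1))
  rw [EReal.coe_ennreal_ofReal]
  exact EReal.coe_le_coe_iff.2 (le_max_left _ _)

lemma integrable_D (t : ℕ) : Integrable (fun ω => (M.D t ω : ℝ)) P :=
  ((M.D_identDistrib t).comp measurable_subtype_coe).integrable_iff.2 M.D_integrable

/-- If `h` is not steep enough at `-∞`, then `f_t` is bounded above near `-∞`. -/
lemma not_tendsto_fFun {α : ℝ} (hα0 : 0 ≤ α) {t : ℕ}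
    (hle : ∀ x : X, x < 0 → M.h x * ∑ i ∈ Finset.range (t + 1), α ^ i ≤ M.c * (-(x : ℝ))) :
    ¬ Tendsto (M.fFun α t) atBot (𝓝 ⊤) := by
  intro htend
  set σ := ∑ i ∈ Finset.range (t + 1), α ^ i
  have hσ : 0 < σ := by
    have : (1 : ℝ) ≤ σ := by
      simpa using Finset.single_le_sum (f := fun i => α ^ i) (fun i _ => pow_nonneg hα0 i)
        (Finset.mem_range.2 t.succ_pos)
    linarith
  have hc := M.c_pos
  -- With this slope, `σ κ (-x)` cancels `c x` exactly, and only the finite demand term `C` is left.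
  set κ := M.c / σ
  have hκ : 0 ≤ κ := by positivity
  have hlin : ∀ x : X, x ≤ 0 → M.h x ≤ κ * (-(x : ℝ)) := by
    intro x hx
    rcases eq_or_lt_of_le hx with rfl | hx
    · simp [M.h_zero]
    · rw [div_mul_eq_mul_div, le_div_iff₀ hσ]; exact hle x hx
  let E : ℕ → ℝ≥0∞ := fun i =>
    ∫⁻ ω, ENNReal.ofReal (κ * ∑ j ∈ Finset.range (i + 1), (M.D j ω : ℝ)) ∂P
  have hE : ∀ i, E i ≠ ⊤ := fun i =>
    ((integrable_finsetSum _ fun j _ => M.integrable_D j).const_mul κ).lintegral_lt_top.ne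
  set C : ℝ≥0∞ := ∑ i ∈ Finset.range (t + 1), ENNReal.ofReal α ^ i * E i
  have hC : C ≠ ⊤ := ENNReal.sum_ne_top.2 fun i _ =>
    ENNReal.mul_ne_top (ENNReal.pow_ne_top ENNReal.ofReal_ne_top) (hE i)
  have hbound : ∀ x : X, x < 0 → M.fFun α t x ≤ (C : EReal) := by
    intro x hx
    have hx' : (x : ℝ) < 0 := hx
    have h1 : ∑ i ∈ Finset.range (t + 1), ENNReal.ofReal α ^ i *
        ∫⁻ ω, ENNReal.ofReal (M.h (x - ∑ j ∈ Finset.range (i + 1), M.D j ω)) ∂P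
        ≤ ENNReal.ofReal (M.c * (-(x : ℝ))) + C := by
      have h2 : M.c * (-(x : ℝ)) = σ * (κ * (-(x : ℝ))) := by simp only [κ]; field_simp
      rw [h2, ENNReal.ofReal_mul hσ.le, ← ofReal_pow_sum hα0, Finset.sum_mul,
        ← Finset.sum_add_distrib]
      refine Finset.sum_le_sum fun i _ => ?_
      rw [← mul_add]
      gcongr
      calc ∫⁻ ω, ENNReal.ofReal (M.h (x - ∑ j ∈ Finset.range (i + 1), M.D j ω)) ∂P
          ≤ ∫⁻ ω, (ENNReal.ofReal (κ * (-(x : ℝ)))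
            + ENNReal.ofReal (κ * ∑ j ∈ Finset.range (i + 1), (M.D j ω : ℝ))) ∂P := by
            refine lintegral_mono_ae ?_
            filter_upwards [M.ae_nonneg_all] with ω hω
            have h3 : 0 ≤ ∑ j ∈ Finset.range (i + 1), M.D j ω := Finset.sum_nonneg fun j _ => hω j
            have h3' : (0 : ℝ) ≤ ∑ j ∈ Finset.range (i + 1), (M.D j ω : ℝ) :=
              Finset.sum_nonneg fun j _ => hω j
            rw [← ENNReal.ofReal_add (by nlinarith) (by positivity)]
            refine ENNReal.ofReal_le_ofReal
              ((hlin _ (sub_nonpos.2 (hx.le.trans h3))).trans_eq ?_)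
            simp only [AddSubgroup.coe_sub, AddSubgroup.val_finsetSum]
            ring
        _ = _ := by rw [lintegral_add_left measurable_const]; simp [E]
    calc M.fFun α t x ≤ ((M.c * (x : ℝ) : ℝ) : EReal)
          + ((ENNReal.ofReal (M.c * (-(x : ℝ))) + C : ℝ≥0∞) : EReal) :=
          add_le_add le_rfl (EReal.coe_ennreal_le_coe_ennreal_iff.2 h1)
      _ = (C : EReal) := by
          rw [EReal.coe_ennreal_add, ← add_assoc, EReal.coe_ennreal_ofReal,
            max_eq_left (by nlinarith), ← EReal.coe_add]
          simp
  have hlt : ((C : ℝ≥0∞) : EReal) < ⊤ := by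
    rw [lt_top_iff_ne_top]
    simpa using hC
  obtain ⟨x, hx1, hx2⟩ := ((htend.eventually (eventually_gt_nhds hlt)).and M.eventually_neg).exists
  exact (hbound x hx2).not_gt hx1

lemma exists_tendsto_of_Nalpha_le {α : ℝ} {t : ℕ} (h : M.Nalpha α ≤ t) :
    ∃ N ≤ t, Tendsto (M.fFun α N) atBot (𝓝 ⊤) := by
  by_contra! hcon
  have : ((t + 1 : ℕ) : ℕ∞) ≤ M.Nalpha α := by
    refine le_iInf₂ fun N hN => ?_
    by_contra! hlt
    exact hcon N (Nat.lt_succ_iff.1 (Nat.cast_lt.1 hlt)) hN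
  exact absurd (Nat.cast_le.1 (this.trans h)) (by omega)

/-- Divergence of `f_N` yields a state whose ratio `q = h(x₀) / (-x₀)` satisfies `c < q ∑_{i≤N}
α^i`, which is the coercivity criterion for `G_N`. -/
lemma exists_coercive_of_Nalpha_le (hh : Continuous M.h) {α : ℝ} (hα0 : 0 ≤ α) (hα1 : α < 1)
    {t : ℕ} (h : M.Nalpha α ≤ t) :
    ∃ N ≤ t, ∃ δ C : ℝ, 0 < δ ∧
      ∀ y : X, δ * (-(y : ℝ)) - C ≤ M.gfun (M.post α (M.viter α N)) y := by
  obtain ⟨N, hNt, hN⟩ := M.exists_tendsto_of_Nalpha_le h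
  obtain ⟨x₀, hx₀, hlt⟩ : ∃ x : X, x < 0 ∧
      M.c * (-(x : ℝ)) < M.h x * ∑ i ∈ Finset.range (N + 1), α ^ i := by
    by_contra! hcon
    exact M.not_tendsto_fFun hα0 hcon hN
  have h0 : (0 : ℝ) < -(x₀ : ℝ) := neg_pos.2 hx₀
  set q := M.h x₀ / (-(x₀ : ℝ))
  have hq : 0 ≤ q := div_nonneg (M.h_nonneg _) h0.le
  have hqx : q * (-(x₀ : ℝ)) = M.h x₀ := div_mul_cancel₀ _ h0.ne'
  refine ⟨N, hNt, M.exists_coercive hh hα0 hα1 hq (M.mul_sub_le_h hq hx₀ hqx.le) ?_⟩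
  rw [← hqx] at hlt
  nlinarith

/-- The geometric sums tend to `1 / (1 - α)`, and `q / (1 - α) > c` for some attained ratio `q`. -/
lemma Nalpha_lt_top {α : ℝ} (hα0 : 0 ≤ α) (hα1 : α < 1) (hα : M.alphaStar < (α : EReal)) :
    M.Nalpha α < ⊤ := by
  obtain ⟨x₀, hx₀, hlt⟩ := (M.alphaStar_lt_iff α).1 hα
  have h0 : (0 : ℝ) < -(x₀ : ℝ) := neg_pos.2 hx₀
  have hα' : 0 < 1 - α := by linarith
  set q := M.h x₀ / (-(x₀ : ℝ))
  have hq : 0 ≤ q := div_nonneg (M.h_nonneg _) h0.le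
  have hqx : q * (-(x₀ : ℝ)) = M.h x₀ := div_mul_cancel₀ _ h0.ne'
  have hqα : (1 - α) * M.c < q := (lt_div_iff₀ h0).2 hlt
  have hlim : M.c < q * (1 - α)⁻¹ := by
    rw [← div_eq_mul_inv, lt_div_iff₀ hα']; linarith
  have htend := ((hasSum_geometric_of_lt_one hα0 hα1).tendsto_sum_nat.const_mul q).comp
    (tendsto_add_atTop_nat 1)
  obtain ⟨t, ht⟩ := (htend.eventually (eventually_gt_nhds hlim)).exists
  exact (iInf₂_le t (M.tendsto_fFun hα0 hq (M.mul_sub_le_h hq hx₀ hqx.le) ht)).trans_lt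
    (ENat.natCast_lt_top t)

/-! ### Optimality of never ordering. -/

/-- A linear bound on `h` near `-∞` bounds the decrease of `h`. -/
lemma h_le_mul_add {κ : ℝ} (hκ : ∀ x : X, x < 0 → M.h x ≤ κ * (-(x : ℝ))) (x : X) (a : Act X) :
    M.h x ≤ κ * ((a : X) : ℝ) + M.h (x + (a : X)) := by
  rcases eq_or_lt_of_le a.2 with h0 | h0
  · simp [← h0]
  by_contra! hlt
  have ha : (0 : ℝ) < ((a : X) : ℝ) := h0
  set A : ℝ := ((a : X) : ℝ)
  set d : ℝ := M.h x - M.h (x + (a : X)) with hd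
  have hgap : 0 < d - κ * A := by linarith
  -- Convexity on `z < x < x + a` gives `(x - z) d ≤ a h(z) ≤ κ a (-z)`, hence `-z (d - κ a) ≤ |x|
  -- |d|`; the threshold puts `z` far enough left to violate this.
  obtain ⟨z, hz, hz0, hzx⟩ := ((M.tendsto_coe_atBot.eventually
    (eventually_lt_atBot (-(|(x : ℝ)| * |d|) / (d - κ * A)))).and
      (M.eventually_neg.and (eventually_le_atBot x))).exists
  have hxa : x < x + (a : X) := lt_add_of_pos_right _ h0
  obtain ⟨l, hl0, hl1, hl, -⟩ := exists_convexComb hzx hxa.le (hzx.trans_lt hxa)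
  have hc := M.h_convex _ _ _ l hl0 hl1 hl
  have hb := hκ z hz0
  rw [AddSubgroup.coe_add] at hl
  have hzx' : (z : ℝ) ≤ x := hzx
  rw [lt_div_iff₀ hgap] at hz
  have hlA : (1 - l) * ((x : ℝ) + A - z) = A := by linarith
  have hlx : l * ((x : ℝ) + A - z) = x - z := by linarith
  have hpos : 0 < (x : ℝ) + A - z := by linarith
  have h1 : ((x : ℝ) + A - z) * M.h x ≤ A * M.h z + (x - z) * M.h (x + (a : X)) := by
    calc ((x : ℝ) + A - z) * M.h x
        ≤ ((x : ℝ) + A - z) * ((1 - l) * M.h z + l * M.h (x + (a : X))) := by gcongr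
      _ = ((1 - l) * ((x : ℝ) + A - z)) * M.h z
          + (l * ((x : ℝ) + A - z)) * M.h (x + (a : X)) := by ring
      _ = _ := by rw [hlA, hlx]
  have h2 : (x : ℝ) * d ≥ -(|(x : ℝ)| * |d|) := by
    rw [← abs_mul]; exact neg_abs_le _
  have h3 := mul_le_mul_of_nonneg_left hb ha.le
  have h4 := mul_nonneg ha.le (M.h_nonneg x)
  have h5 : ((x : ℝ) - z) * d ≤ A * M.h z - A * M.h x := by rw [hd]; linarith
  linarith

/-- The cost-to-go of never ordering. -/
noncomputable def idle (α : ℝ) : ℕ → X → ℝ≥0∞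
  | 0 => 0
  | n + 1 => M.post α (idle α n)

lemma expHold_le_ofReal_add {κ : ℝ} (hκ0 : 0 ≤ κ)
    (hκ : ∀ x : X, x < 0 → M.h x ≤ κ * (-(x : ℝ))) (x : X) (a : Act X) :
    M.expHold x ≤ ENNReal.ofReal (κ * ((a : X) : ℝ)) + M.expHold (x + (a : X)) := by
  have ha : (0 : ℝ) ≤ ((a : X) : ℝ) := a.2
  calc M.expHold x ≤ ∫⁻ ω, (ENNReal.ofReal (κ * ((a : X) : ℝ))
        + ENNReal.ofReal (M.h (x + (a : X) - M.D 0 ω))) ∂P := by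
        refine lintegral_mono fun ω => ?_
        rw [← ENNReal.ofReal_add (by positivity) (M.h_nonneg _)]
        refine ENNReal.ofReal_le_ofReal ((M.h_le_mul_add hκ _ a).trans_eq ?_)
        rw [sub_add_eq_add_sub]
    _ = _ := by rw [lintegral_add_left measurable_const]; simp [expHold]

/-- An order of `a` saves at most `(1 - α) c a` now and, by induction, `α c a` later: together, its
price. -/
lemma idle_le_ofReal_add {α : ℝ} (hα0 : 0 ≤ α) (hα1 : α < 1)
    (hκ : ∀ x : X, x < 0 → M.h x ≤ (1 - α) * M.c * (-(x : ℝ))) (n : ℕ) (x : X) (a : Act X) :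
    M.idle α n x ≤ ENNReal.ofReal (M.c * ((a : X) : ℝ)) + M.idle α n (x + (a : X)) := by
  have ha : (0 : ℝ) ≤ ((a : X) : ℝ) := a.2
  have hc := M.c_pos
  have hα' : 0 ≤ 1 - α := by linarith
  induction n generalizing x with
  | zero => exact zero_le
  | succ n ih =>
    have h1 := M.expHold_le_ofReal_add (mul_nonneg hα' hc.le) hκ x a
    have h2 : ∫⁻ ω, M.idle α n (x - M.D 0 ω) ∂P ≤ ENNReal.ofReal (M.c * ((a : X) : ℝ))
        + ∫⁻ ω, M.idle α n (x + (a : X) - M.D 0 ω) ∂P := by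
      calc _ ≤ ∫⁻ ω, (ENNReal.ofReal (M.c * ((a : X) : ℝ))
            + M.idle α n (x + (a : X) - M.D 0 ω)) ∂P := by
            refine lintegral_mono fun ω => (ih (x - M.D 0 ω)).trans_eq ?_
            rw [sub_add_eq_add_sub]
        _ = _ := by rw [lintegral_add_left measurable_const]; simp
    calc M.idle α (n + 1) x
        ≤ (ENNReal.ofReal ((1 - α) * M.c * ((a : X) : ℝ)) + M.expHold (x + (a : X)))
          + ENNReal.ofReal α * (ENNReal.ofReal (M.c * ((a : X) : ℝ))
            + ∫⁻ ω, M.idle α n (x + (a : X) - M.D 0 ω) ∂P) := by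
          change M.post α (M.idle α n) x ≤ _
          unfold post
          gcongr
      _ = (ENNReal.ofReal ((1 - α) * M.c * ((a : X) : ℝ))
          + ENNReal.ofReal (α * (M.c * ((a : X) : ℝ)))) + M.idle α (n + 1) (x + (a : X)) := by
          rw [ENNReal.ofReal_mul hα0]
          change _ = _ + M.post α (M.idle α n) _
          unfold post
          ring
      _ = _ := by
          rw [← ENNReal.ofReal_add (by positivity) (by positivity)]
          congr 2
          ring

lemma measurable_post (hh : Continuous M.h) (α : ℝ) {v : X → ℝ≥0∞} (hv : Measurable v) :
    Measurable (M.post α v) :=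
  (M.lowerSemicontinuous_expHold hh).measurable.add ((M.measurable_lintegral_sub hv).const_mul _)

lemma measurable_idle (hh : Continuous M.h) (α : ℝ) (n : ℕ) : Measurable (M.idle α n) := by
  induction n with
  | zero => exact measurable_const
  | succ n ih => exact M.measurable_post hh α ih

/-- Never ordering is optimal when the holding cost is not steep at `-∞`. -/
theorem isOptimal_neverOrder (hh : Continuous M.h) {α : ℝ} (hα0 : 0 ≤ α) (hα1 : α < 1)
    (hκ : ∀ x : X, x < 0 → M.h x ≤ (1 - α) * M.c * (-(x : ℝ))) :
    M.IsOptimal α (neverOrder X) := by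
  intro x
  refine le_antisymm (le_iInf fun π => ?_) (iInf_le _ _)
  rw [infCost_eq_iSup]
  refine iSup_le fun N => ?_
  have hup : M.finCost α N (neverOrder X) x ≤ M.idle α N x := by
    refine M.finCost_markovPolicy_le hh (φ := fun _ _ => ⟨0, le_rfl⟩) (fun _ => measurable_const)
      (u := fun t => M.idle α (N - t)) (fun n => M.measurable_idle hh α _) N
      (fun t ht x => ?_) x
    rw [M.cost_add, show N - t = N - (t + 1) + 1 by omega]
    simp [qval, orderCost, idle]
  have hlow : M.idle α N x ≤ M.finCost α N π x := by
    refine M.le_finCost hh (M.measurable_idle hh α) rfl (fun n x a => ?_) N π x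
    rw [M.cost_add]
    refine (M.idle_le_ofReal_add hα0 hα1 hκ (n + 1) x a).trans ?_
    unfold qval orderCost
    gcongr
    · exact le_add_self
    · exact le_rfl
  exact hup.trans (hlow.trans (M.finCost_le_infCost α N π x))

/-! ### Minimizers, reorder points and passage to the limit in the horizon. -/

section Coercive

variable {g : X → ℝ} {δ C : ℝ}

/-- The bound depends on `g` only through `δ` and `C`, so it is uniform over horizons. -/
lemma abs_le_of_coercive (hδ : 0 < δ) (hg1 : ∀ y : X, δ * (-(y : ℝ)) - C ≤ g y)
    (hg2 : ∀ y : X, M.c * y ≤ g y) (r : ℝ) {y : X} (hy : g y ≤ r) :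
    |(y : ℝ)| ≤ max |(-((r + C) / δ))| |r / M.c| := by
  refine abs_le_max_abs_abs ?_ ?_
  · rw [neg_le, le_div_iff₀ hδ]
    linarith [hg1 y]
  · rw [le_div_iff₀ M.c_pos]
    linarith [hg2 y]

lemma exists_argmin_of_coercive (hXc : IsClosed (X : Set ℝ)) (hlsc : LowerSemicontinuous g)
    (hδ : 0 < δ) (hg1 : ∀ y : X, δ * (-(y : ℝ)) - C ≤ g y) (hg2 : ∀ y : X, M.c * y ≤ g y) :
    ∃ S, ∀ y, g S ≤ g y := by
  obtain ⟨S, -, hmin⟩ := LowerSemicontinuousOn.exists_isMinOn (s := {y | g y ≤ g 0})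
    ⟨0, le_refl (g 0)⟩ (isCompact_of_isClosed_of_abs_le hXc (hlsc.isClosed_preimage _)
      fun y hy => M.abs_le_of_coercive hδ hg1 hg2 (g 0) hy) (hlsc.lowerSemicontinuousOn _)
  refine ⟨S, fun y => ?_⟩
  rcases le_total (g y) (g 0) with h | h
  · exact hmin h
  · exact (hmin (le_refl (g 0))).trans h

/-- Closedness and compactness turn the infimum defining `s` into a minimum, so `s` itself satisfies
`g s ≤ K + g S`. -/
lemma exists_isLeast_of_coercive (hXc : IsClosed (X : Set ℝ)) (hlsc : LowerSemicontinuous g)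
    (hδ : 0 < δ) (hg1 : ∀ y : X, δ * (-(y : ℝ)) - C ≤ g y) (hg2 : ∀ y : X, M.c * y ≤ g y)
    (S : X) : ∃ s, IsLeast {x | x ≤ S ∧ g x ≤ M.K + g S} s :=
  (isCompact_of_isClosed_of_abs_le hXc (isClosed_Iic.inter (hlsc.isClosed_preimage _))
    fun _ hy => M.abs_le_of_coercive hδ hg1 hg2 (M.K + g S) hy.2).exists_isLeast
      ⟨S, le_refl S, show g S ≤ M.K + g S by linarith [M.K_pos]⟩

end Coercive

lemma isArgmin_coe_iff {g : X → ℝ} {S : X} :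
    IsArgmin (fun y => (g y : EReal)) S ↔ ∀ y, g S ≤ g y :=
  forall_congr' fun _ => EReal.coe_le_coe_iff

lemma isReorderPoint_coe_iff {g : X → ℝ} {S s : X} :
    M.IsReorderPoint (fun y => (g y : EReal)) S s
      ↔ IsGLB {x | x ≤ S ∧ g x ≤ M.K + g S} s := by
  unfold IsReorderPoint
  simp only [← EReal.coe_add, EReal.coe_le_coe_iff]

lemma coe_gfun {w : X → ℝ≥0∞} {y : X} (hw : w y ≠ ⊤) :
    ((M.c * (y : ℝ) : ℝ) : EReal) + (w y : EReal) = (M.gfun w y : EReal) := by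
  rw [gfun, EReal.coe_add, EReal.coe_ennreal_toReal hw]

lemma finG_eq (hXc : IsClosed (X : Set ℝ)) (hh : Continuous M.h) {α : ℝ} (hα0 : 0 ≤ α)
    (hα1 : α < 1) (t : ℕ) :
    M.finG α t = fun y => (M.gfun (M.post α (M.viter α t)) y : EReal) := by
  funext y
  rw [← M.coe_gfun (M.post_viter_ne_top hh hα0 hα1 t y), finG,
    M.finValue_eq_viter hXc hh hα0 hα1]
  rfl

lemma gfun_mono {w w' : X → ℝ≥0∞} (hw' : ∀ y, w' y ≠ ⊤) (h : w ≤ w') (y : X) :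
    M.gfun w y ≤ M.gfun w' y :=
  add_le_add le_rfl (ENNReal.toReal_mono (hw' y) (h y))

lemma gfun_post_viter_le (hh : Continuous M.h) {α : ℝ} (hα0 : 0 ≤ α) (hα1 : α < 1) {m n : ℕ}
    (hmn : m ≤ n) (y : X) :
    M.gfun (M.post α (M.viter α m)) y ≤ M.gfun (M.post α (M.viter α n)) y :=
  M.gfun_mono (M.post_viter_ne_top hh hα0 hα1 n) (M.post_mono α (M.viter_mono α hmn)) y

lemma gfun_post_viter_le_vlim (hh : Continuous M.h) {α : ℝ} (hα0 : 0 ≤ α) (hα1 : α < 1) (n : ℕ)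
    (y : X) : M.gfun (M.post α (M.viter α n)) y ≤ M.gfun (M.post α (M.vlim α)) y :=
  M.gfun_mono (M.post_vlim_ne_top hh hα0 hα1) (M.post_mono α (M.viter_le_vlim α n)) y

/-- Monotone convergence, in the form in which bounds for all finite horizons reach the limit. -/
lemma gfun_post_vlim_le (hXc : IsClosed (X : Set ℝ)) (hh : Continuous M.h) {α : ℝ} (hα0 : 0 ≤ α)
    (hα1 : α < 1) {y : X} {r : ℝ} (h : ∀ n, M.gfun (M.post α (M.viter α n)) y ≤ r) :
    M.gfun (M.post α (M.vlim α)) y ≤ r := by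
  have h0 : 0 ≤ r - M.c * y := by linarith [M.le_gfun (M.post α (M.viter α 0)) y, h 0]
  have : M.post α (M.vlim α) y ≤ ENNReal.ofReal (r - M.c * y) := by
    rw [M.post_vlim_eq hXc hh]
    refine iSup_le fun n => ?_
    rw [ENNReal.le_ofReal_iff_toReal_le (M.post_viter_ne_top hh hα0 hα1 n y) h0]
    have := h n
    unfold gfun at this
    linarith
  rw [ENNReal.le_ofReal_iff_toReal_le (M.post_vlim_ne_top hh hα0 hα1 y) h0] at this
  unfold gfun
  linarith

lemma infG_eq (hh : Continuous M.h) {α : ℝ} (hα0 : 0 ≤ α) (hα1 : α < 1)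
    (hv : M.infValue α = M.vlim α) :
    M.infG α = fun y => (M.gfun (M.post α (M.vlim α)) y : EReal) := by
  funext y
  rw [← M.coe_gfun (M.post_vlim_ne_top hh hα0 hα1 y), infG, hv]
  rfl

lemma lowerSemicontinuous_gfun_viter (hXc : IsClosed (X : Set ℝ)) (hh : Continuous M.h) {α : ℝ}
    (hα0 : 0 ≤ α) (hα1 : α < 1) (n : ℕ) :
    LowerSemicontinuous (M.gfun (M.post α (M.viter α n))) :=
  M.lowerSemicontinuous_gfun (M.post_viter_ne_top hh hα0 hα1 n)
    (M.lowerSemicontinuous_post hh α (M.lowerSemicontinuous_viter hXc hh α n))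

lemma lowerSemicontinuous_gfun_vlim (hXc : IsClosed (X : Set ℝ)) (hh : Continuous M.h) {α : ℝ}
    (hα0 : 0 ≤ α) (hα1 : α < 1) : LowerSemicontinuous (M.gfun (M.post α (M.vlim α))) :=
  M.lowerSemicontinuous_gfun (M.post_vlim_ne_top hh hα0 hα1)
    (M.lowerSemicontinuous_post hh α (M.lowerSemicontinuous_vlim hXc hh α))

lemma isOptimal_of_infCost_le (hXc : IsClosed (X : Set ℝ)) (hh : Continuous M.h) {α : ℝ}
    {π : Policy X} (h : ∀ x, M.infCost α π x ≤ M.vlim α x) : M.IsOptimal α π := fun x =>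
  le_antisymm ((h x).trans (M.vlim_le_infValue hXc hh α x)) (iInf_le _ _)

lemma infValue_eq_vlim (hXc : IsClosed (X : Set ℝ)) (hh : Continuous M.h) {α : ℝ}
    {π : Policy X} (h : ∀ x, M.infCost α π x ≤ M.vlim α x) : M.infValue α = M.vlim α :=
  funext fun x => le_antisymm ((iInf_le _ π).trans (h x)) (M.vlim_le_infValue hXc hh α x)

lemma infCost_sSPolicy_le_of_isLeast (hXc : IsClosed (X : Set ℝ)) (hh : Continuous M.h) {α : ℝ}
    (hα0 : 0 ≤ α) (hα1 : α < 1) {s S : X}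
    (hS : ∀ y, M.gfun (M.post α (M.vlim α)) S ≤ M.gfun (M.post α (M.vlim α)) y)
    (hs : IsLeast {x | x ≤ S ∧ M.gfun (M.post α (M.vlim α)) x
      ≤ M.K + M.gfun (M.post α (M.vlim α)) S} s) (x : X) :
    M.infCost α (sSPolicy s S hs.1.1) x ≤ M.vlim α x := by
  refine M.infCost_sSPolicy_le hXc hh hα0 hα1 hs.1.1 hS hs.1.2 (fun y hy => ?_) x
  by_contra! hlt
  exact (hs.2 ⟨hy.le.trans hs.1.1, hlt.le⟩).not_gt hy

/-- Limit points of optimal parameters for finite horizons are optimal for the infinite horizon. -/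
lemma infCost_sSPolicy_le_of_mapClusterPt (hXc : IsClosed (X : Set ℝ)) (hh : Continuous M.h)
    {α : ℝ} (hα0 : 0 ≤ α) (hα1 : α < 1) {s S : ℕ → X} {S₀ s' S' : X}
    (hS₀ : ∀ y, M.gfun (M.post α (M.vlim α)) S₀ ≤ M.gfun (M.post α (M.vlim α)) y)
    (hpair : ∀ᶠ t in atTop,
      (∀ y, M.gfun (M.post α (M.viter α t)) (S t) ≤ M.gfun (M.post α (M.viter α t)) y) ∧
      IsLeast {x | x ≤ S t ∧ M.gfun (M.post α (M.viter α t)) x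
        ≤ M.K + M.gfun (M.post α (M.viter α t)) (S t)} (s t))
    (hcl : MapClusterPt (s', S') atTop (fun t => (s t, S t))) :
    ∃ hsS : s' ≤ S', ∀ x, M.infCost α (sSPolicy s' S' hsS) x ≤ M.vlim α x := by
  set G := M.gfun (M.post α (M.vlim α))
  set F : ℕ → X → ℝ := fun n => M.gfun (M.post α (M.viter α n))
  have hFG : ∀ n y, F n y ≤ G y := M.gfun_post_viter_le_vlim hh hα0 hα1
  have hFF : ∀ {m n : ℕ}, m ≤ n → ∀ y, F m y ≤ F n y := M.gfun_post_viter_le hh hα0 hα1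
  have hlsc : ∀ n, LowerSemicontinuous (F n) := M.lowerSemicontinuous_gfun_viter hXc hh hα0 hα1
  have hclosed : ∀ A : Set (X × X), IsClosed A → (∀ᶠ t in atTop, (s t, S t) ∈ A) →
      (s', S') ∈ A := by
    intro A hA hev
    by_contra hnot
    obtain ⟨t, ht1, ht2⟩ :=
      ((mapClusterPt_iff_frequently.1 hcl _ (hA.isOpen_compl.mem_nhds hnot)).and_eventually
        hev).exists
    exact ht1 ht2
  have hsS : s' ≤ S' := hclosed {p | p.1 ≤ p.2} (isClosed_le continuous_fst continuous_snd)
    (hpair.mono fun t ht => ht.2.1.1)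
  -- For fixed `n` and `t ≥ n`, `F_n(S_t) ≤ F_t(S_t) ≤ F_t(S₀) ≤ G(S₀)`. Lower semicontinuity of
  -- `F_n` carries this to `S'`; then `n` varies.
  have hS'le : G S' ≤ G S₀ := by
    refine M.gfun_post_vlim_le hXc hh hα0 hα1 fun n => ?_
    refine hclosed {p | F n p.2 ≤ G S₀}
      (((hlsc n).isClosed_preimage _).preimage continuous_snd) ?_
    filter_upwards [hpair, eventually_ge_atTop n] with t ht hnt
    exact (hFF hnt _).trans ((ht.1 S₀).trans (hFG t S₀))
  have hS' : ∀ y, G S' ≤ G y := fun y => hS'le.trans (hS₀ y)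
  have hs' : G s' ≤ M.K + G S' := by
    refine M.gfun_post_vlim_le hXc hh hα0 hα1 fun n => ?_
    refine hclosed {p | F n p.1 ≤ M.K + G S'}
      (((hlsc n).isClosed_preimage _).preimage continuous_fst) ?_
    filter_upwards [hpair, eventually_ge_atTop n] with t ht hnt
    have h1 := hFF hnt (s t)
    have h2 := ht.2.1.2
    have h3 := ht.1 S'
    have h4 := hFG t S'
    change F n (s t) ≤ M.K + G S'
    change F t (s t) ≤ M.K + F t (S t) at h2
    change F t (S t) ≤ F t S' at h3
    linarith
  refine ⟨hsS, M.infCost_sSPolicy_le hXc hh hα0 hα1 hsS hS' hs' fun x hx => ?_⟩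
  by_contra! hlt
  -- If `x < s'` had `G(x) < K + G(S')`, some `F_n(S')` would already exceed `G(x) - K`. This is an
  -- open condition, so it holds at `S_t` with `x < s_t` for some large `t`, and `F_t(x) ≤ K +
  -- F_t(S_t)` contradicts minimality of `s_t`.
  obtain ⟨n, hn⟩ : ∃ n, G x - M.K < F n S' := by
    by_contra! hcon
    have := M.gfun_post_vlim_le hXc hh hα0 hα1 hcon
    linarith
  have hU : {p : X × X | x < p.1 ∧ G x - M.K < F n p.2} ∈ 𝓝 (s', S') :=
    ((isOpen_lt continuous_const continuous_fst).inter
      (((hlsc n).isOpen_preimage _).preimage continuous_snd)).mem_nhds ⟨hx, hn⟩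
  obtain ⟨t, ⟨ht1, ht2⟩, ht3, hnt⟩ := ((mapClusterPt_iff_frequently.1 hcl _ hU).and_eventually
    (hpair.and (eventually_ge_atTop n))).exists
  have h1 := hFF hnt (S t)
  have h2 := hFG t x
  refine (ht3.2.2 ⟨ht1.le.trans ht3.2.1.1, ?_⟩).not_gt ht1
  change F t x ≤ M.K + F t (S t)
  change G x - M.K < F n (S t) at ht2
  linarith

end Model

end Inventory

/-! ### Assembly. -/

theorem theorem4p2
    (X : AddSubgroup ℝ) (hX : X = ⊤ ∨ X = (Int.castAddHom ℝ).range)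
    {Ω : Type*} [MeasurableSpace Ω] (P : Measure Ω) [IsProbabilityMeasure P]
    (M : Inventory.Model X P) (α : ℝ) (hα0 : 0 ≤ α) (hα1 : α < 1) :
    (M.alphaStar < (α : EReal) →
      -- minimizers `S_α` of `G_α` and the corresponding `s_α` exist, and each of the resulting
      -- `(s_α, S_α)` policies is optimal
      ((∃ S, Inventory.Model.IsArgmin (M.infG α) S) ∧
        (∀ S, Inventory.Model.IsArgmin (M.infG α) S →
          ∃ s, M.IsReorderPoint (M.infG α) S s) ∧
        (∀ S s, Inventory.Model.IsArgmin (M.infG α) S → M.IsReorderPoint (M.infG α) S s →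
          ∃ hsS : s ≤ S, M.IsOptimal α (Inventory.sSPolicy s S hsS))) ∧
      -- pairs `(s_{t,α}, S_{t,α})` exist for all `t ≥ N_α`
      M.Nalpha α < ⊤ ∧
      (∀ t : ℕ, M.Nalpha α ≤ t →
        (∃ S, Inventory.Model.IsArgmin (M.finG α t) S) ∧
        (∀ S, Inventory.Model.IsArgmin (M.finG α t) S →
          ∃ s, M.IsReorderPoint (M.finG α t) S s)) ∧
      -- every such sequence is bounded, and its limit points give optimal policies
      (∀ s S : ℕ → X,
        (∀ t : ℕ, M.Nalpha α ≤ t → Inventory.Model.IsArgmin (M.finG α t) (S t) ∧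
          M.IsReorderPoint (M.finG α t) (S t) (s t)) →
        (∃ B : ℝ, ∀ t : ℕ, M.Nalpha α ≤ t → |(s t : ℝ)| ≤ B ∧ |(S t : ℝ)| ≤ B) ∧
        (∀ s' S' : X, MapClusterPt (s', S') atTop (fun t => (s t, S t)) →
          ∃ hsS : s' ≤ S', M.IsOptimal α (Inventory.sSPolicy s' S' hsS)))) ∧
    ((α : EReal) ≤ M.alphaStar → M.IsOptimal α (Inventory.neverOrder X)) := by
  have hXc := Inventory.isClosed_stateSpace hX
  have hh := M.continuous_h hX
  refine ⟨fun hα => ?_, fun hα => ?_⟩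
  swap
  · refine M.isOptimal_neverOrder hh hα0 hα1 fun x hx => ?_
    by_contra! hlt
    exact ((M.alphaStar_lt_iff α).2 ⟨x, hx, hlt⟩).not_ge hα
  have hNtop := M.Nalpha_lt_top hα0 hα1 hα
  obtain ⟨N₀, hN₀⟩ := ENat.ne_top_iff_exists.1 hNtop.ne
  -- Coercivity at one index `N ≤ N_α` spreads to all later `G_t` and to `G` by monotonicity, with
  -- the same `δ` and `C`.
  obtain ⟨N, hNN₀, δ, C, hδ, hcoer⟩ := M.exists_coercive_of_Nalpha_le hh hα0 hα1 hN₀.symm.le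
  have hNt : ∀ t : ℕ, M.Nalpha α ≤ t → N ≤ t := fun t ht =>
    hNN₀.trans (Nat.cast_le.1 (hN₀.trans_le ht))
  set G := M.gfun (M.post α (M.vlim α)) with hG
  set F : ℕ → X → ℝ := fun n => M.gfun (M.post α (M.viter α n)) with hF
  have hFcoer : ∀ t : ℕ, M.Nalpha α ≤ t → ∀ y : X, δ * (-(y : ℝ)) - C ≤ F t y := fun t ht y =>
    (hcoer y).trans (M.gfun_post_viter_le hh hα0 hα1 (hNt t ht) y)
  have hGcoer : ∀ y : X, δ * (-(y : ℝ)) - C ≤ G y := fun y =>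
    (hcoer y).trans (M.gfun_post_viter_le_vlim hh hα0 hα1 N y)
  have hGlsc := M.lowerSemicontinuous_gfun_vlim hXc hh hα0 hα1
  have hFlsc := M.lowerSemicontinuous_gfun_viter hXc hh hα0 hα1
  have hGlin : ∀ y : X, M.c * y ≤ G y := M.le_gfun _
  have hFlin : ∀ t (y : X), M.c * y ≤ F t y := fun t => M.le_gfun _
  obtain ⟨S₀, hS₀⟩ := M.exists_argmin_of_coercive hXc hGlsc hδ hGcoer hGlin
  have hGleast := M.exists_isLeast_of_coercive hXc hGlsc hδ hGcoer hGlin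
  have hFleast := fun t ht => M.exists_isLeast_of_coercive hXc (hFlsc t) hδ (hFcoer t ht) (hFlin t)
  -- `infG` involves `infValue`, which is identified with `vlim` only through an `(s, S)` policy
  -- that attains it.
  have hinfG : M.infG α = fun y => (G y : EReal) := by
    obtain ⟨s₀, hs₀⟩ := hGleast S₀
    exact M.infG_eq hh hα0 hα1
      (M.infValue_eq_vlim hXc hh (M.infCost_sSPolicy_le_of_isLeast hXc hh hα0 hα1 hS₀ hs₀))
  have hfinG : ∀ t, M.finG α t = fun y => (F t y : EReal) := M.finG_eq hXc hh hα0 hα1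
  simp only [hinfG, hfinG, Inventory.Model.isArgmin_coe_iff, M.isReorderPoint_coe_iff]
  refine ⟨⟨⟨S₀, hS₀⟩, fun S _ => (hGleast S).imp fun s hs => hs.isGLB, fun S s hS hs => ?_⟩, hNtop,
    fun t ht => ⟨M.exists_argmin_of_coercive hXc (hFlsc t) hδ (hFcoer t ht) (hFlin t),
      fun S _ => (hFleast t ht S).imp fun s hs => hs.isGLB⟩, fun s S hpair => ?_⟩
  · obtain ⟨s₁, hs₁⟩ := hGleast S
    obtain rfl := hs.unique hs₁.isGLB
    exact ⟨hs₁.1.1, M.isOptimal_of_infCost_le hXc hh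
      (M.infCost_sSPolicy_le_of_isLeast hXc hh hα0 hα1 hS hs₁)⟩
  have hpair' : ∀ t : ℕ, M.Nalpha α ≤ t → (∀ y, F t (S t) ≤ F t y) ∧
      IsLeast {x | x ≤ S t ∧ F t x ≤ M.K + F t (S t)} (s t) := by
    intro t ht
    obtain ⟨hS, hs⟩ := hpair t ht
    obtain ⟨s₁, hs₁⟩ := hFleast t ht (S t)
    rw [hs.unique hs₁.isGLB]
    exact ⟨hS, hs₁⟩
  refine ⟨?_, fun s' S' hcl => ?_⟩
  -- The level `K + G(0)` works for every `t`, because `F_t(S_t) ≤ F_t(0) ≤ G(0)`.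
  · refine ⟨max |(-((M.K + G 0 + C) / δ))| |(M.K + G 0) / M.c|, fun t ht => ?_⟩
    obtain ⟨hS, hs⟩ := hpair' t ht
    have h0 : F t (S t) ≤ G 0 := (hS 0).trans (M.gfun_post_viter_le_vlim hh hα0 hα1 t 0)
    exact ⟨M.abs_le_of_coercive hδ (hFcoer t ht) (hFlin t) (M.K + G 0)
        (hs.1.2.trans (by linarith)),
      M.abs_le_of_coercive hδ (hFcoer t ht) (hFlin t) (M.K + G 0)
        (by linarith [M.K_pos])⟩
  · have hev : ∀ᶠ t : ℕ in atTop, M.Nalpha α ≤ t :=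
      (eventually_ge_atTop N₀).mono fun t ht => hN₀.symm.le.trans (Nat.cast_le.2 ht)
    obtain ⟨hsS, h⟩ := M.infCost_sSPolicy_le_of_mapClusterPt hXc hh hα0 hα1 hS₀
      (hev.mono hpair') hcl
    exact ⟨hsS, M.isOptimal_of_infCost_le hXc hh h⟩
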